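/- **Setup.** Let $\mathfrak H=\mathbb Q\langle e_0,e_1\rangle$ and $\mathfrak H^1=\mathbb Q\cdot 1+e_1\mathfrak H$, which has as a $\mathbb Q$-basis the monomials $e_{k_1}\cdots e_{k_r}$ with $r\ge 0$, $k_i\ge 1$, where $e_k=e_1e_0^{k-1}$. Let ш be the shuffle product on $\mathfrak H$, given by $1\,ш\,w=w\,ш\,1=w$ and $av\,ш\,bw=a(v\,ш\,bw)+b(av\,ш\,w)$ for $a,b\in\{e_0,e_1\}$ and words $v,w$ (it restricts to $\mathfrak H^1$), and let $*$ be the harmonic product on $\mathfrak H^1$, given by $1*w=w*1=w$ and $e_kv*e_lw=e_k(v*e_lw)+e_l(e_kv*w)+e_{k+l}(v*w)$ for $k,l\ge1$. For words $u,v\in\mathfrak H^1$ put $\mathrm{ds}(u,v)=u*v-u\,ш\,v\in\mathfrak H^1$. For $n_1,\dots,n_m\ge1$ let $$H\binom{n_1,\dots,n_m}{Y_1,\dots,Y_m}=\sum_{0<d_1<\dots<d_m}\ \prod_{l=1}^m e^{d_lY_l}\Big(\frac{q^{d_l}}{1-q^{d_l}}\Big)^{n_l},$$ and for $r\ge1$,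 $k_1,\dots,k_r\ge 1$ define $g^{ш}_{k_1,\dots,k_r}\in\mathbb Q[[q]]$ as the coefficient of $X_1^{k_1-1}\cdots X_r^{k_r-1}$ in $$T_ш(X_1,\dots,X_r)=\sum_{m=1}^r\ \sum_{\substack{i_1+\dots+i_m=r\\ i_1,\dots,i_m\ge1}}\frac{1}{i_1!\cdots i_m!}\,H\binom{i_1,\,i_2,\,\dots,\,i_m}{X_r-X_{r-i_1},\,X_{r-i_1}-X_{r-i_1-i_2},\,\dots,\,X_{i_m}};$$ for $r=0$ put $g^ш=1$. Let $\mathfrak g^ш:\mathfrak H^1\to\mathbb Q[[q]]$ be the $\mathbb Q$-linear map with $e_{k_1}\cdots e_{k_r}\mapsto g^ш_{k_1,\dots,k_r}$, let $\mathcal G^ш_{\le k}$ be the $\mathbb Q$-span of all $g^ш_{k_1,\dots,k_r}$ with $r\ge 0$ and $k_1+\dots+k_r\le k$, and let $\mathrm d=q\frac{d}{dq}$. **Theorem.** For all integers $k_1,k_2,k_3\ge2$: i) modulo $\mathcal G^ш_{\le k_1+k_2+1}$, $$\mathrm d\,g^ш_{k_1,k_2}\equiv 2k_1\big(\mathfrak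 g^ш(\mathrm{ds}(e_1,e_{k_1+1}e_{k_2}))-\mathfrak g^ш(\mathrm{ds}(e_{k_2},e_{k_1+1}e_1))\big)+2k_2\,\mathfrak g^ш(\mathrm{ds}(e_1,e_{k_1}e_{k_2+1}));$$ ii) modulo $\mathcal G^ш_{\le k_1+k_2+k_3+1}$, $$\begin{aligned}\mathrm d\,g^ш_{k_1,k_2,k_3}\equiv{}&2k_1\,\mathfrak g^ш\big(\mathrm{ds}(e_1,e_{k_1+1}e_{k_2}e_{k_3})+\mathrm{ds}(e_{k_3},e_{k_2}e_{k_1+1}e_1)\big)\\&+2k_1\,\mathfrak g^ш\big(\mathrm{ds}(e_{k_3},e_{k_1+1+k_2}e_1)-\mathrm{ds}(e_{k_1+1}e_1,e_{k_2}e_{k_3})\big)\\&+2k_2\,\mathfrak g^ш\big(\mathrm{ds}(e_1,e_{k_1}e_{k_2+1}e_{k_3})-\mathrm{ds}(e_{k_3},e_{k_1}e_{k_2+1}e_1)\big)\\&+2k_3\,\mathfrak g^ш\big(\mathrm{ds}(e_1,e_{k_1}e_{k_2}e_{k_3+1})\big).\end{aligned}$$ In particular, $\mathrm d\,g^ш_{k_1,k_2}$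 and $\mathrm d\,g^ш_{k_1,k_2,k_3}$ are $\mathbb Q$-linear combinations of series $g^ш_{l_1,\dots,l_s}$ with $s\ge0$, $l_i\ge1$. -/

import Mathlib

open scoped PowerSeries

noncomputable section

namespace QMZV

/-! ### Words, the shuffle product, the harmonic product, and `ds` -/

/-- The underlying vector space of `ℌ = ℚ⟨e₀, e₁⟩`: it has the words in `e₀`, `e₁` as a basis.
The letter `e₀` is `0 : Fin 2`, the letter `e₁` is `1 : Fin 2`. -/
abbrev H := List (Fin 2) →₀ ℚ

/-- The underlying vector space of `ℌ¹ = ℚ·1 + e₁ℌ`, described through its basis of the monomials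
`e_{k₁} ⋯ e_{kᵣ}`, `kᵢ ≥ 1`; the list `[k₁, …, kᵣ]` stands for `e_{k₁} ⋯ e_{kᵣ}`. -/
abbrev H1 := List ℕ+ →₀ ℚ

/-- Left multiplication by a letter, extended linearly from words. -/
def prepend {α : Type} (a : α) : (List α →₀ ℚ) →ₗ[ℚ] (List α →₀ ℚ) :=
  Finsupp.lmapDomain ℚ ℚ (List.cons a)

/-- The shuffle product of two words of `ℌ`. -/
def shuffle : List (Fin 2) → List (Fin 2) → H
  | [], w => Finsupp.single w 1
  | a :: v, [] => Finsupp.single (a :: v) 1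
  | a :: v, b :: w => prepend a (shuffle v (b :: w)) + prepend b (shuffle (a :: v) w)
termination_by v w => v.length + w.length

/-- The harmonic (stuffle) product of two words of `ℌ¹`. -/
def stuffle : List ℕ+ → List ℕ+ → H1
  | [], w => Finsupp.single w 1
  | k :: v, [] => Finsupp.single (k :: v) 1
  | k :: v, l :: w =>
      prepend k (stuffle v (l :: w)) + prepend l (stuffle (k :: v) w) + prepend (k + l) (stuffle v w)
termination_by v w => v.length + w.length

/-- The word in `e₀`, `e₁` of the monomial `e_{k₁} ⋯ e_{kᵣ}`, where `e_k = e₁ e₀^{k-1}`. -/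
def toWord : List ℕ+ → List (Fin 2)
  | [] => []
  | k :: ks => 1 :: (List.replicate ((k : ℕ) - 1) 0 ++ toWord ks)

theorem toWord_zeros (ks : List ℕ+) (n : ℕ) :
    (List.replicate n (0 : Fin 2) ++ toWord ks).takeWhile (· == 0) = List.replicate n 0 := by
  induction n with
  | zero => cases ks <;> simp [toWord]
  | succ n ih => simp [List.replicate_succ, ih]

theorem toWord_injective : Function.Injective toWord := by
  intro u
  induction u with
  | nil => intro v h; cases v <;> simp_all [toWord]
  | cons k ks ih =>
    intro v h
    cases v with
    | nil => simp [toWord] at h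
    | cons l ls =>
      simp only [toWord, List.cons.injEq, true_and] at h
      have h1 := congrArg (List.takeWhile (· == 0)) h
      rw [toWord_zeros, toWord_zeros] at h1
      have h2 : (k : ℕ) - 1 = (l : ℕ) - 1 := by simpa using congrArg List.length h1
      have hkl : k = l := by
        apply PNat.eq
        have := k.pos
        have := l.pos
        omega
      rw [h2] at h
      rw [hkl, ih (List.append_cancel_left h)]

/-- The shuffle product of two words of `ℌ¹ ⊂ ℌ`, as an element of `ℌ¹`: the coefficient of
`e_{k₁} ⋯ e_{kᵣ}` is its coefficient in the shuffle product in `ℌ`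
(nothing is lost, see `mapDomain_shuffle1`). -/
def shuffle1 (u v : List ℕ+) : H1 :=
  Finsupp.comapDomain toWord (shuffle (toWord u) (toWord v)) toWord_injective.injOn

/-- `ds(u,v) = u ∗ v - u ш v` for words `u`, `v` of `ℌ¹`. -/
def ds (u v : List ℕ+) : H1 := stuffle u v - shuffle1 u v

/-- Every word is a power of `e₀` followed by a word of `ℌ¹`. -/
theorem exists_toWord (w : List (Fin 2)) :
    ∃ (n : ℕ) (ks : List ℕ+), w = List.replicate n 0 ++ toWord ks := by
  induction w with
  | nil => exact ⟨0, [], rfl⟩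
  | cons a w ih =>
    obtain ⟨n, ks, rfl⟩ := ih
    fin_cases a
    · exact ⟨n + 1, ks, rfl⟩
    · exact ⟨0, n.succPNat :: ks, by simp [toWord]⟩

/-- `ℌ¹` is closed under the shuffle product, and `shuffle1` is that product. -/
theorem mapDomain_shuffle1 (u v : List ℕ+) :
    Finsupp.mapDomain toWord (shuffle1 u v) = shuffle (toWord u) (toWord v) := by
  classical
  have hpre : ∀ x : H, (((prepend 1 x : H).support : Finset _) : Set (List (Fin 2))) ⊆
      Set.range toWord := by
    intro x w hw
    have hw' := Finsupp.mapDomain_support hw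
    obtain ⟨w', -, rfl⟩ := Finset.mem_image.1 hw'
    obtain ⟨n, ks, rfl⟩ := exists_toWord w'
    exact ⟨n.succPNat :: ks, by simp [toWord]⟩
  have hsingle : ∀ w : List ℕ+, (((Finsupp.single (toWord w) 1 : H).support : Finset _) :
      Set (List (Fin 2))) ⊆ Set.range toWord := by
    intro w x hx
    have := Finsupp.support_single_subset hx
    exact ⟨w, (Finset.mem_singleton.1 this).symm⟩
  refine Finsupp.mapDomain_comapDomain _ toWord_injective _ ?_
  cases u with
  | nil =>
    have h := hsingle v
    rwa [show shuffle (toWord []) (toWord v) = Finsupp.single (toWord v) 1 by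
      simp [toWord, shuffle]]
  | cons k ks =>
    cases v with
    | nil => simpa [toWord, shuffle] using hsingle (k :: ks)
    | cons l ls =>
      simp only [toWord, shuffle, ← map_add]
      exact hpre _

/-! ### The `q`-series `g^ш` -/

/-- `q^d / (1 - q^d)`. -/
def qFrac (d : ℕ) : ℚ⟦X⟧ := PowerSeries.X ^ d * (1 - PowerSeries.X ^ d)⁻¹

/-- Formal power series in `X₁, …, Xᵣ` with coefficients in `ℚ[[q]]`. -/
abbrev GenSeries (r : ℕ) := MvPowerSeries (Fin r) ℚ⟦X⟧

/-- `e^Y` for a series `Y` without constant term. -/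
def expSeries {r : ℕ} (Y : GenSeries r) : GenSeries r := (PowerSeries.exp ℚ).subst Y

/-- The summand of `hSeries n Y` that belongs to `d₁ < ⋯ < d_m`:
`∏ᵢ e^{dᵢ Yᵢ} (q^{dᵢ} / (1 - q^{dᵢ}))^{nᵢ}`. -/
def hTerm {r m : ℕ} (n : Fin m → ℕ) (Y : Fin m → GenSeries r) (d : Fin m → ℕ) : GenSeries r :=
  ∏ i, (expSeries ((d i : GenSeries r) * Y i) * MvPowerSeries.C (qFrac (d i) ^ n i))

/-- The series `H(n₁,…,n_m; Y₁,…,Y_m)`, the sum over all `0 < d₁ < ⋯ < d_m` of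
`e^{d₁ Y₁} (q^{d₁} / (1 - q^{d₁}))^{n₁} ⋯ e^{d_m Y_m} (q^{d_m} / (1 - q^{d_m}))^{n_m}`, where
`Y₁, …, Y_m` are power series in `X₁, …, Xᵣ` without constant term. The infinite sum is taken
coefficient by coefficient; each of these sums is finite if all `nᵢ ≥ 1` (`hTerm_finite`). -/
def hSeries {r m : ℕ} (n : Fin m → ℕ) (Y : Fin m → GenSeries r) : GenSeries r := fun a =>
  PowerSeries.mk fun N =>
    ∑ᶠ d : {d : Fin m → ℕ // StrictMono d ∧ ∀ i, 0 < d i},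
      PowerSeries.coeff N (MvPowerSeries.coeff a (hTerm n Y d))

theorem hTerm_finite {r m : ℕ} (n : Fin m → ℕ) (hn : ∀ i, 1 ≤ n i) (Y : Fin m → GenSeries r)
    (a : Fin r →₀ ℕ) (N : ℕ) :
    (Function.support fun d : {d : Fin m → ℕ // StrictMono d ∧ ∀ i, 0 < d i} =>
      PowerSeries.coeff N (MvPowerSeries.coeff a (hTerm n Y d))).Finite := by
  have hfin : {d : {d : Fin m → ℕ // StrictMono d ∧ ∀ i, 0 < d i} |
      ∀ i, d.1 i ≤ N}.Finite := by
    refine Set.Finite.preimage (f := Subtype.val) (s := {d : Fin m → ℕ | ∀ i, d i ≤ N})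
      Subtype.val_injective.injOn ?_
    refine (Set.Finite.pi' (t := fun _ : Fin m => Set.Iic N) fun _ => Set.finite_Iic N).subset ?_
    intro d hd i
    exact hd i
  refine hfin.subset ?_
  rintro ⟨d, hd⟩ h i
  by_contra hlt
  apply h
  have hdvd : (PowerSeries.X : ℚ⟦X⟧) ^ d i ∣ qFrac (d i) ^ n i :=
    (dvd_mul_right _ _).trans (dvd_pow_self _ (by have := hn i; omega))
  obtain ⟨c, hc⟩ := hdvd
  have hT : hTerm n Y d = MvPowerSeries.C ((PowerSeries.X : ℚ⟦X⟧) ^ d i) *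
      (expSeries ((d i : GenSeries r) * Y i) * MvPowerSeries.C c *
        ∏ j ∈ Finset.univ.erase i,
          (expSeries ((d j : GenSeries r) * Y j) * MvPowerSeries.C (qFrac (d j) ^ n j))) := by
    rw [hTerm, ← Finset.mul_prod_erase _ _ (Finset.mem_univ i), hc, map_mul]
    ring
  simp only
  rw [hT, MvPowerSeries.coeff_C_mul, PowerSeries.coeff_X_pow_mul', if_neg]
  exact hlt

/-- The variable `X_j`, `1 ≤ j ≤ r`, together with the convention `X_0 = 0`. -/
def xVar (r j : ℕ) : GenSeries r :=
  if h : 1 ≤ j ∧ j ≤ r then MvPowerSeries.X ⟨j - 1, by omega⟩ else 0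

/-- The generating series `T_ш(X₁,…,Xᵣ)`: the sum over all compositions `i₁ + ⋯ + i_m = r` of
`1 / (i₁! ⋯ i_m!)` times
`H(i₁,…,i_m; Xᵣ - X_{r-i₁}, X_{r-i₁} - X_{r-i₁-i₂}, …, X_{i_m})`.
Here `c.sizeUpTo l = i₁ + ⋯ + i_l`. -/
def tSh (r : ℕ) : GenSeries r :=
  ∑ c : Composition r,
    (1 / ∏ l, ((c.blocksFun l).factorial : ℚ)) •
      hSeries c.blocksFun fun l =>
        xVar r (r - c.sizeUpTo l) - xVar r (r - c.sizeUpTo (l + 1))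

/-- `g^ш_{k₁,…,kᵣ}`, the coefficient of `X₁^{k₁-1} ⋯ Xᵣ^{kᵣ-1}` in `T_ш(X₁,…,Xᵣ)`. For `r = 0` it
is `1` (see `gsh_nil`). -/
def gsh (ks : List ℕ+) : ℚ⟦X⟧ :=
  MvPowerSeries.coeff (Finsupp.equivFunOnFinite.symm fun j : Fin ks.length => (ks.get j : ℕ) - 1)
    (tSh ks.length)

theorem gsh_nil : gsh [] = 1 := by
  have hH : ∀ c : Composition 0, ∀ Y : Fin c.length → GenSeries 0,
      hSeries c.blocksFun Y = 1 := by
    intro c Y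
    have h0 : c.length = 0 := Nat.le_zero.1 c.length_le
    have : IsEmpty (Fin c.length) := by rw [h0]; infer_instance
    funext a
    ext N
    have hu : ∀ d : Fin c.length → ℕ, hTerm c.blocksFun Y d = 1 := fun d => by simp [hTerm]
    rw [hSeries, PowerSeries.coeff_mk]
    simp only [hu]
    rw [finsum_eq_single _ ⟨isEmptyElim, fun i => isEmptyElim i, fun i => isEmptyElim i⟩]
    · rfl
    · rintro ⟨d, hd⟩ h
      exact absurd (Subtype.ext (Subsingleton.elim _ _)) h
  have hT : tSh 0 = 1 := by
    have hc : ∀ c : Composition 0, c = Composition.ones 0 := fun c => by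
      have h0 : c.blocks.length = 0 := Nat.le_zero.1 c.length_le
      apply Composition.ext
      rw [List.eq_nil_of_length_eq_zero h0]
      rfl
    rw [tSh, Fintype.sum_eq_single (Composition.ones 0) fun c h => absurd (hc c) h, hH]
    simp
  have h : gsh [] = MvPowerSeries.coeff 0 (tSh 0) :=
    congrArg (fun a => MvPowerSeries.coeff a (tSh 0))
      (Finsupp.ext fun j => Fin.elim0 j)
  rw [h, hT]
  simp

/-- The `ℚ`-linear map `𝔤^ш : ℌ¹ → ℚ[[q]]` with `e_{k₁} ⋯ e_{kᵣ} ↦ g^ш_{k₁,…,kᵣ}`. -/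
def gshMap : H1 →ₗ[ℚ] ℚ⟦X⟧ := Finsupp.linearCombination ℚ gsh

/-- `𝒢^ш_{≤ k}`, the span of all `g^ш_{k₁,…,kᵣ}` of weight `k₁ + ⋯ + kᵣ ≤ k`
(so automatically `0 ≤ r ≤ k`). -/
def gshLE (k : ℕ) : Submodule ℚ ℚ⟦X⟧ :=
  Submodule.span ℚ {f | ∃ ks : List ℕ+, (ks.map (fun i : ℕ+ => (i : ℕ))).sum ≤ k ∧ f = gsh ks}

/-- The operator `d = q d/dq` on `ℚ[[q]]`. -/
def qD (f : ℚ⟦X⟧) : ℚ⟦X⟧ := PowerSeries.X * PowerSeries.derivative ℚ f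

end QMZV

end

open QMZV

/-! The shuffle side. Each `pathChar N` is a finite product of exponentials of the letters `e₀` and
`u_d e₁`, with `u_d = q^d / (1 - q^d)`. Removing a fixed first letter is a derivation for the
shuffle product, so these exponentials are shuffle characters. Their coefficients satisfy the
recursion that governs `T_ш` truncated at `d < N`, hence `gshMap` agrees with `pathChar L` modulo
`q^L` for every `L` and is multiplicative (`gshMap_shuffle1`). So `gshMap (ds u v)` measures how far
the `g^ш` are from satisfying the harmonic product formula.

The harmonic side. Expanding `q^(dM) u_d = ∑_{b > M} q^(db)` and exchanging the roles of `d` and `b`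
turns `gsh ks` into the nested sum of `letter k₁ (b₁) ⋯ letter k_r (b_r)` over `0 < b₁ < ⋯ < b_r`,
provided that no letter except possibly the last is `e₁` (`gsh_eq_nest`). Nested sums multiply by
the quasi-shuffle rule, and `letter k b * letter l b` is `letter (k + l) b` plus letters of smaller
weight (`exists_letter_mul_letter`). An `e₁` before a letter `k ≠ 1` adds a term of its own: the
block of length two contributes `u_d² / 2`, which expands with coefficients `(b - M - 1) / 2`, where
`b` is the index of the letter after the `e₁` and `M` that of the letter before it. Thus `gshMap (ds
u v)`, for the pairs used here, is modulo lower weight half a difference of nested sums in which one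
letter is multiplied by its summation index.

The derivative. On the other hand `d` sends `letter k b` to `k b letter (k + 1) b` (`qD_letter`), so
`d g^ш` is a sum of nested sums of exactly that kind. The lemmas `gshMap_ds_…_sub_mem` list what
each `ds` contributes, and the theorem is the linear combination in which all index-weighted terms
but the desired ones cancel. -/

noncomputable section

namespace QMZV

/-! ### Sums of power series -/

/-- The sum of `f b` over `b > M`, for a family with `X ^ b ∣ f b`. -/
def bsum (M : ℕ) (f : ℕ → ℚ⟦X⟧) : ℚ⟦X⟧ :=
  PowerSeries.mk fun n => ∑ b ∈ Finset.Ioc M n, PowerSeries.coeff n (f b)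

theorem coeff_bsum (M n : ℕ) (f : ℕ → ℚ⟦X⟧) :
    PowerSeries.coeff n (bsum M f) = ∑ b ∈ Finset.Ioc M n, PowerSeries.coeff n (f b) := by
  simp [bsum]

theorem bsum_congr {M : ℕ} {f g : ℕ → ℚ⟦X⟧} (h : ∀ b, M < b → f b = g b) :
    bsum M f = bsum M g := by
  ext n
  rw [coeff_bsum, coeff_bsum]
  exact Finset.sum_congr rfl fun b hb => by rw [h b (Finset.mem_Ioc.1 hb).1]

theorem bsum_add (M : ℕ) (f g : ℕ → ℚ⟦X⟧) :
    bsum M (fun b => f b + g b) = bsum M f + bsum M g := by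
  ext n; simp [coeff_bsum, Finset.sum_add_distrib]

theorem bsum_sub (M : ℕ) (f g : ℕ → ℚ⟦X⟧) :
    bsum M (fun b => f b - g b) = bsum M f - bsum M g := by
  ext n; simp [coeff_bsum, Finset.sum_sub_distrib]

theorem bsum_smul (M : ℕ) (c : ℚ) (f : ℕ → ℚ⟦X⟧) :
    bsum M (fun b => c • f b) = c • bsum M f := by
  ext n; simp [coeff_bsum, Finset.mul_sum]

theorem bsum_sum {ι : Type*} (s : Finset ι) (M : ℕ) (f : ι → ℕ → ℚ⟦X⟧) :
    bsum M (fun b => ∑ i ∈ s, f i b) = ∑ i ∈ s, bsum M (f i) := by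
  ext n
  simp only [coeff_bsum, map_sum]
  exact Finset.sum_comm

/-- No divisibility hypothesis is needed, since every coefficient of a `bsum` is a finite sum by
definition. -/
theorem bsum_comm (M N : ℕ) (F : ℕ → ℕ → ℚ⟦X⟧) :
    bsum M (fun a => bsum N fun b => F a b) = bsum N (fun b => bsum M fun a => F a b) := by
  ext n
  simp only [coeff_bsum]
  exact Finset.sum_comm

/-- Reduction modulo `X ^ L`. -/
abbrev modX (L : ℕ) : ℚ⟦X⟧ →+* ℚ⟦X⟧ ⧸ Ideal.span {(PowerSeries.X : ℚ⟦X⟧) ^ L} :=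
  Ideal.Quotient.mk _

theorem modX_eq_iff {L : ℕ} {f g : ℚ⟦X⟧} :
    modX L f = modX L g ↔ ∀ n < L, PowerSeries.coeff n f = PowerSeries.coeff n g := by
  rw [Ideal.Quotient.eq, Ideal.mem_span_singleton, PowerSeries.X_pow_dvd_iff]
  simp [sub_eq_zero]

theorem eq_of_forall_modX {f g : ℚ⟦X⟧} (h : ∀ L, modX L f = modX L g) : f = g := by
  ext n
  exact modX_eq_iff.1 (h (n + 1)) n (Nat.lt_succ_self n)

theorem modX_eq_zero {L : ℕ} {f : ℚ⟦X⟧} {b : ℕ} (hb : L ≤ b) (h : PowerSeries.X ^ b ∣ f) :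
    modX L f = 0 := by
  rw [Ideal.Quotient.eq_zero_iff_mem, Ideal.mem_span_singleton]
  exact (pow_dvd_pow _ hb).trans h

theorem modX_bsum (L M : ℕ) {f : ℕ → ℚ⟦X⟧} (hf : ∀ b, PowerSeries.X ^ b ∣ f b) :
    modX L (bsum M f) = ∑ b ∈ Finset.Ioc M L, modX L (f b) := by
  rw [← map_sum, modX_eq_iff]
  intro n hn
  rw [coeff_bsum, map_sum]
  refine Finset.sum_subset (Finset.Ioc_subset_Ioc_right hn.le) fun b hb hb' => ?_
  simp only [Finset.mem_Ioc, not_and, not_le] at hb hb'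
  exact PowerSeries.X_pow_dvd_iff.1 (hf b) n (hb' hb.1)

/-- Pairs of indices are split into `b < c`, `c < b` and `b = c`, the three terms of the
quasi-shuffle recursion. The induction lowers `M` from `L`. -/
theorem sum_Ioc_mul_sum_Ioc {A : Type*} [CommRing A] (F G : ℕ → A) (M L : ℕ) :
    (∑ b ∈ Finset.Ioc M L, F b) * ∑ b ∈ Finset.Ioc M L, G b =
      ∑ b ∈ Finset.Ioc M L, F b * ∑ c ∈ Finset.Ioc b L, G c +
        ∑ b ∈ Finset.Ioc M L, G b * ∑ c ∈ Finset.Ioc b L, F c +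
        ∑ b ∈ Finset.Ioc M L, F b * G b := by
  rcases le_total L M with h | h
  · simp [Finset.Ioc_eq_empty_of_le h]
  induction h using Nat.decreasingInduction with
  | self => simp
  | of_succ k hk ih =>
    have hs : Finset.Ioc k L = insert (k + 1) (Finset.Ioc (k + 1) L) := by
      ext x; simp only [Finset.mem_Ioc, Finset.mem_insert]; omega
    rw [hs]
    simp only [Finset.sum_insert (by simp : k + 1 ∉ Finset.Ioc (k + 1) L)]
    linear_combination ih

theorem bsum_mul (M : ℕ) {f g : ℕ → ℚ⟦X⟧} (hf : ∀ b, PowerSeries.X ^ b ∣ f b)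
    (hg : ∀ b, PowerSeries.X ^ b ∣ g b) :
    bsum M f * bsum M g = bsum M (fun b => f b * bsum b g) + bsum M (fun b => g b * bsum b f) +
      bsum M (fun b => f b * g b) := by
  refine eq_of_forall_modX fun L => ?_
  simp only [map_mul, map_add, modX_bsum L _ hf, modX_bsum L _ hg,
    modX_bsum L _ fun b => (hf b).mul_right (bsum b g),
    modX_bsum L _ fun b => (hg b).mul_right (bsum b f),
    modX_bsum L _ fun b => (hf b).mul_right (g b)]
  exact sum_Ioc_mul_sum_Ioc _ _ _ _

theorem mul_bsum (M : ℕ) (c : ℚ⟦X⟧) {f : ℕ → ℚ⟦X⟧} (hf : ∀ b, PowerSeries.X ^ b ∣ f b) :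
    c * bsum M f = bsum M fun b => c * f b := by
  refine eq_of_forall_modX fun L => ?_
  simp only [map_mul, modX_bsum L _ hf, modX_bsum L _ fun b => (hf b).mul_left c, Finset.mul_sum]

theorem X_pow_dvd_X_pow_mul {M : ℕ} (hM : 1 ≤ M) (d : ℕ) (f : ℚ⟦X⟧) :
    (PowerSeries.X : ℚ⟦X⟧) ^ d ∣ PowerSeries.X ^ (d * M) * f :=
  (pow_dvd_pow _ (Nat.le_mul_of_pos_right d hM)).mul_right f

/-- Cauchy product along `d = a + δ`. The inner range on the left contains `δ = 0`, which the factor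
on the right omits; hence `h 0 = 0`. With `1 ≤ M` the sums converge `q`-adically. -/
theorem bsum_convolution {M : ℕ} (hM : 1 ≤ M) (p h : ℕ → ℚ⟦X⟧) (h0 : h 0 = 0) :
    bsum 0 (fun d => PowerSeries.X ^ (d * M) * ∑ δ ∈ Finset.range d, p (d - δ) * h δ) =
      bsum 0 (fun a => PowerSeries.X ^ (a * M) * p a) *
        bsum 0 (fun δ => PowerSeries.X ^ (δ * M) * h δ) := by
  refine eq_of_forall_modX fun L => ?_
  rw [map_mul, modX_bsum L _ fun d => X_pow_dvd_X_pow_mul hM d _,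
    modX_bsum L _ fun d => X_pow_dvd_X_pow_mul hM d _,
    modX_bsum L _ fun d => X_pow_dvd_X_pow_mul hM d _]
  have h1 : ∀ d ∈ Finset.Ioc 0 L,
      modX L (PowerSeries.X ^ (d * M) * ∑ δ ∈ Finset.range d, p (d - δ) * h δ) =
      ∑ δ ∈ Finset.Ioc 0 L, if δ < d then
        modX L (PowerSeries.X ^ (d * M) * (p (d - δ) * h δ)) else 0 := by
    intro d hd
    rw [Finset.mul_sum, map_sum, ← Finset.sum_filter]
    symm
    refine Finset.sum_subset_zero_on_sdiff (fun δ hδ => ?_) (fun δ hδ => ?_) fun _ _ => rfl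
    · simp only [Finset.mem_filter, Finset.mem_Ioc, Finset.mem_range] at hδ ⊢
      exact hδ.2
    · simp only [Finset.mem_sdiff, Finset.mem_filter, Finset.mem_Ioc, Finset.mem_range] at hδ hd
      have : δ = 0 := by omega
      simp [this, h0]
  rw [Finset.sum_congr rfl h1, Finset.sum_comm, mul_comm, Finset.sum_mul]
  refine Finset.sum_congr rfl fun δ hδ => ?_
  rw [Finset.mem_Ioc] at hδ
  rw [Finset.mul_sum, ← Finset.sum_filter]
  have h2 : (Finset.Ioc 0 L).filter (fun d => δ < d) =
      (Finset.Ioc 0 (L - δ)).map (addRightEmbedding δ) := by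
    ext d
    simp only [Finset.mem_filter, Finset.mem_Ioc, Finset.mem_map, addRightEmbedding_apply]
    constructor
    · intro hd
      exact ⟨d - δ, by omega, by omega⟩
    · rintro ⟨a, ha, rfl⟩
      omega
  rw [h2, Finset.sum_map]
  have h3 : ∀ a, modX L (PowerSeries.X ^ (δ * M) * h δ) * modX L (PowerSeries.X ^ (a * M) * p a) =
      modX L (PowerSeries.X ^ ((a + δ) * M) * (p (a + δ - δ) * h δ)) := by
    intro a
    rw [← map_mul, Nat.add_sub_cancel]
    congr 1
    ring
  simp only [addRightEmbedding_apply, h3]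
  refine Finset.sum_subset (Finset.Ioc_subset_Ioc_right (Nat.sub_le _ _)) fun a _ ha' => ?_
  simp only [Finset.mem_Ioc, not_and, not_le] at ha' hδ
  exact modX_eq_zero (b := a + δ) (by grind) (X_pow_dvd_X_pow_mul hM _ _)

theorem coeff_qD (n : ℕ) (f : ℚ⟦X⟧) :
    PowerSeries.coeff n (qD f) = n * PowerSeries.coeff n f := by
  rw [qD]
  cases n with
  | zero => simp
  | succ n => rw [PowerSeries.coeff_succ_X_mul, PowerSeries.coeff_derivative]; push_cast; ring

theorem qD_bsum (M : ℕ) (f : ℕ → ℚ⟦X⟧) : qD (bsum M f) = bsum M fun b => qD (f b) := by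
  ext n
  simp only [coeff_qD, coeff_bsum, Finset.mul_sum]

theorem qD_mul (f g : ℚ⟦X⟧) : qD (f * g) = qD f * g + f * qD g := by
  simp only [qD, Derivation.leibniz, smul_eq_mul]
  ring

theorem qFrac_zero : qFrac 0 = 0 := by simp [qFrac]

theorem one_sub_mul_qFrac {d : ℕ} (hd : 1 ≤ d) :
    (1 - PowerSeries.X ^ d) * qFrac d = (PowerSeries.X : ℚ⟦X⟧) ^ d := by
  have h : PowerSeries.constantCoeff (1 - (PowerSeries.X : ℚ⟦X⟧) ^ d) ≠ 0 := by
    simp [zero_pow (show d ≠ 0 by omega)]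
  rw [qFrac, mul_left_comm, PowerSeries.mul_inv_cancel _ h, mul_one]

theorem one_sub_X_pow_ne_zero {d : ℕ} (hd : 1 ≤ d) : (1 - (PowerSeries.X : ℚ⟦X⟧) ^ d) ≠ 0 := by
  intro h
  have := congrArg PowerSeries.constantCoeff h
  simp [zero_pow (show d ≠ 0 by omega)] at this

theorem one_sub_mul_sum_Ioc_pow {A : Type*} [CommRing A] (y : A) {M L : ℕ} (h : M ≤ L) :
    (1 - y) * ∑ b ∈ Finset.Ioc M L, y ^ b = y ^ (M + 1) - y ^ (L + 1) := by
  induction L, h using Nat.le_induction with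
  | base => simp
  | succ n hn ih =>
    rw [Finset.sum_Ioc_succ_top hn, mul_add, ih]
    ring

theorem one_sub_mul_sum_Ioc_mul_pow {A : Type*} [CommRing A] (y : A) {M L : ℕ} (h : M ≤ L) :
    (1 - y) * ∑ b ∈ Finset.Ioc M L, ((b : A) - M - 1) * y ^ b =
      y * ∑ b ∈ Finset.Ioc M L, y ^ b - ((L : A) - M) * y ^ (L + 1) := by
  induction L, h using Nat.le_induction with
  | base => simp
  | succ n hn ih =>
    rw [Finset.sum_Ioc_succ_top hn, Finset.sum_Ioc_succ_top hn, mul_add, ih]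
    push_cast
    ring

theorem X_pow_dvd_X_pow_mul' {d : ℕ} (hd : 1 ≤ d) (b : ℕ) :
    (PowerSeries.X : ℚ⟦X⟧) ^ b ∣ PowerSeries.X ^ (d * b) :=
  pow_dvd_pow _ (Nat.le_mul_of_pos_left b hd)

/-- A geometric series; it introduces the conjugate summation index `b`. -/
theorem X_pow_mul_qFrac {d : ℕ} (hd : 1 ≤ d) (M : ℕ) :
    PowerSeries.X ^ (d * M) * qFrac d = bsum M fun b => PowerSeries.X ^ (d * b) := by
  refine mul_left_cancel₀ (one_sub_X_pow_ne_zero hd) ?_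
  rw [mul_left_comm, one_sub_mul_qFrac hd, ← pow_add, ← Nat.mul_succ]
  refine eq_of_forall_modX fun L => ?_
  rw [map_mul, modX_bsum L _ fun b => X_pow_dvd_X_pow_mul' hd b]
  rcases le_or_gt M L with h | h
  · simp only [map_sub, map_one, map_pow, pow_mul]
    rw [one_sub_mul_sum_Ioc_pow _ h]
    simp only [← map_pow, ← pow_mul]
    rw [modX_eq_zero (b := L + 1) (Nat.le_succ L) (X_pow_dvd_X_pow_mul' hd (L + 1)), sub_zero]
  · rw [Finset.Ioc_eq_empty_of_le h.le]
    simp [modX_eq_zero (L := L) (b := M + 1) (by omega) (X_pow_dvd_X_pow_mul' hd (M + 1)),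
      -map_pow]

/-- For `b > M` the coefficient `b - M - 1` counts the integers strictly between `M` and `b`. It is
the source of all index-weighted letters below. -/
theorem X_pow_mul_qFrac_sq {d : ℕ} (hd : 1 ≤ d) (M : ℕ) :
    PowerSeries.X ^ (d * M) * qFrac d ^ 2 =
      bsum M fun b : ℕ => ((b : ℚ⟦X⟧) - (M : ℚ⟦X⟧) - 1) * PowerSeries.X ^ (d * b) := by
  refine mul_left_cancel₀ (one_sub_X_pow_ne_zero hd) ?_
  have h1 : (1 - PowerSeries.X ^ d) * (PowerSeries.X ^ (d * M) * qFrac d ^ 2) =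
      PowerSeries.X ^ d * (PowerSeries.X ^ (d * M) * qFrac d) := by
    linear_combination (PowerSeries.X ^ (d * M) * qFrac d) * one_sub_mul_qFrac hd
  rw [h1, X_pow_mul_qFrac hd]
  refine eq_of_forall_modX fun L => ?_
  rw [map_mul, map_mul, modX_bsum L _ fun b => X_pow_dvd_X_pow_mul' hd b,
    modX_bsum L _ fun b => (X_pow_dvd_X_pow_mul' hd b).mul_left _]
  rcases le_or_gt M L with h | h
  · simp only [map_sub, map_one, map_pow, map_mul, map_natCast, pow_mul]
    rw [one_sub_mul_sum_Ioc_mul_pow _ h]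
    simp only [← map_pow, ← pow_mul]
    rw [modX_eq_zero (b := L + 1) (Nat.le_succ L) (X_pow_dvd_X_pow_mul' hd (L + 1)), mul_zero,
      sub_zero]
  · simp [Finset.Ioc_eq_empty_of_le h.le]

/-! ### Shuffle characters -/

/-- The linear map that removes the first letter `a` of a word, and kills the words that do not
start with `a`. -/
def unprepend (a : Fin 2) : H →ₗ[ℚ] H :=
  Finsupp.linearCombination ℚ fun w : List (Fin 2) =>
    if w.head? = some a then Finsupp.single w.tail 1 else 0

@[simp]
theorem unprepend_single_nil (a : Fin 2) : unprepend a (Finsupp.single [] 1) = 0 := by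
  simp [unprepend]

@[simp]
theorem unprepend_single_cons (a b : Fin 2) (w : List (Fin 2)) :
    unprepend a (Finsupp.single (b :: w) 1) = if b = a then Finsupp.single w 1 else 0 := by
  simp [unprepend]

@[simp]
theorem prepend_single {α : Type} (a : α) (w : List α) (c : ℚ) :
    prepend a (Finsupp.single w c) = Finsupp.single (a :: w) c := by
  simp [prepend]

theorem unprepend_prepend (a b : Fin 2) (x : H) :
    unprepend a (prepend b x) = if b = a then x else 0 := by
  induction x using Finsupp.induction_linear with
  | zero => simp
  | add x y hx hy => rw [map_add, map_add, hx, hy]; split_ifs <;> simp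
  | single w c =>
    rw [← mul_one c, ← smul_eq_mul, ← Finsupp.smul_single, map_smul, map_smul, prepend_single,
      unprepend_single_cons]
    split_ifs <;> simp

/-- The shuffle product as a bilinear map. -/
def shuffleBilin : H →ₗ[ℚ] H →ₗ[ℚ] H :=
  Finsupp.linearCombination ℚ fun u => Finsupp.linearCombination ℚ fun v => shuffle u v

@[simp]
theorem shuffleBilin_single (u v : List (Fin 2)) :
    shuffleBilin (Finsupp.single u 1) (Finsupp.single v 1) = shuffle u v := by
  simp [shuffleBilin]

@[simp]
theorem shuffle_nil_left (w : List (Fin 2)) : shuffle [] w = Finsupp.single w 1 := by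
  simp [shuffle]

@[simp]
theorem shuffle_nil_right (w : List (Fin 2)) : shuffle w [] = Finsupp.single w 1 := by
  cases w <;> simp [shuffle]

/-- Leibniz rule: the first letter of a shuffle comes from one of the two factors. -/
theorem unprepend_shuffle (a : Fin 2) (u v : List (Fin 2)) :
    unprepend a (shuffle u v) =
      shuffleBilin (unprepend a (Finsupp.single u 1)) (Finsupp.single v 1) +
        shuffleBilin (Finsupp.single u 1) (unprepend a (Finsupp.single v 1)) := by
  rcases u with _ | ⟨b, u⟩
  · rcases v with _ | ⟨c, v⟩
    · simp
    · by_cases h : c = a <;> simp [h]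
  · rcases v with _ | ⟨c, v⟩
    · by_cases h : b = a <;> simp [h]
    · rw [shuffle, map_add, unprepend_prepend, unprepend_prepend, unprepend_single_cons,
        unprepend_single_cons]
      by_cases h : b = a <;> by_cases h' : c = a <;> simp [h, h']

theorem unprepend_shuffleBilin (a : Fin 2) (x y : H) :
    unprepend a (shuffleBilin x y) =
      shuffleBilin (unprepend a x) y + shuffleBilin x (unprepend a y) := by
  have h : shuffleBilin.compr₂ (unprepend a) =
      shuffleBilin.comp (unprepend a) + shuffleBilin.compl₂ (unprepend a) := by
    ext u v : 4
    simpa using unprepend_shuffle a u v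
  exact LinearMap.congr_fun (LinearMap.congr_fun h x) y

/-- The divided powers of `unprepend a`. -/
def unprependPow (a : Fin 2) (n : ℕ) : H →ₗ[ℚ] H := (1 / (n.factorial : ℚ)) • unprepend a ^ n


open Finset.HasAntidiagonal in
theorem unprepend_pow_shuffleBilin (a : Fin 2) (n : ℕ) (x y : H) :
    (unprepend a ^ n) (shuffleBilin x y) = ∑ p ∈ antidiagonal n,
      n.choose p.1 • shuffleBilin ((unprepend a ^ p.1) x) ((unprepend a ^ p.2) y) := by
  induction n with
  | zero => simp
  | succ n ih =>
    rw [Finset.sum_antidiagonal_choose_succ_nsmul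
      (fun i j => shuffleBilin ((unprepend a ^ i) x) ((unprepend a ^ j) y)) n]
    simp only [pow_succ', Module.End.mul_apply, ih, map_sum, map_nsmul, unprepend_shuffleBilin,
      smul_add, Finset.sum_add_distrib]
    rw [add_comm]
    congr 1
    refine Finset.sum_congr rfl fun p hp => ?_
    rw [n.choose_symm_of_eq_add (Finset.HasAntidiagonal.mem_antidiagonal.1 hp).symm]

-- Dividing by `n!` absorbs the binomial coefficients of the Leibniz formula, as multiplicativity of
-- the exponential requires.
open Finset.HasAntidiagonal in
theorem unprependPow_shuffleBilin (a : Fin 2) (n : ℕ) (x y : H) :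
    unprependPow a n (shuffleBilin x y) =
      ∑ p ∈ antidiagonal n,
        shuffleBilin (unprependPow a p.1 x) (unprependPow a p.2 y) := by
  simp only [unprependPow, LinearMap.smul_apply, unprepend_pow_shuffleBilin, Finset.smul_sum,
    map_smul]
  refine Finset.sum_congr rfl fun p hp => ?_
  obtain rfl := Finset.HasAntidiagonal.mem_antidiagonal.1 hp
  rw [← Nat.cast_smul_eq_nsmul ℚ, smul_smul, smul_smul, Nat.cast_add_choose]
  congr 1
  have := Nat.factorial_ne_zero (p.1 + p.2)
  field_simp

theorem unprependPow_single_of_lt (a : Fin 2) (w : List (Fin 2)) (n : ℕ) (h : w.length < n) :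
    unprependPow a n (Finsupp.single w 1) = 0 := by
  have key : (unprepend a ^ n) (Finsupp.single w 1) = 0 := by
    induction n generalizing w with
    | zero => simp at h
    | succ n ih =>
      rw [pow_succ, Module.End.mul_apply]
      cases w with
      | nil => simp
      | cons b w =>
        rw [unprepend_single_cons]
        split_ifs
        · exact ih w (by simpa using h)
        · simp
  rw [unprependPow, LinearMap.smul_apply, key, smul_zero]

/-- A shuffle involves no words longer than the two factors together. Stating this through
functionals lets the induction absorb each first letter into `ψ`. -/
theorem eq_zero_on_shuffle {R : Type*} [AddCommGroup R] [Module ℚ R] (u v : List (Fin 2))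
    (ψ : H →ₗ[ℚ] R)
    (h : ∀ w : List (Fin 2), w.length ≤ u.length + v.length → ψ (Finsupp.single w 1) = 0) :
    ψ (shuffle u v) = 0 := by
  induction hn : u.length + v.length generalizing u v ψ with
  | zero =>
    have hu : u = [] := List.eq_nil_of_length_eq_zero (by omega)
    subst hu
    simpa using h v (by simp)
  | succ n ih =>
    cases u with
    | nil => simpa using h v (by simp)
    | cons a u =>
      cases v with
      | nil => simpa using h (a :: u) (by simp)
      | cons b v =>
        simp only [List.length_cons] at h hn
        rw [shuffle, map_add, ← LinearMap.comp_apply, ← LinearMap.comp_apply,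
          ih u (b :: v) (ψ ∘ₗ prepend a), ih (a :: u) v (ψ ∘ₗ prepend b), add_zero]
        · intro w hw
          simp only [List.length_cons] at hw
          simpa using h (b :: w) (by simp; omega)
        · simp; omega
        · intro w hw
          simp only [List.length_cons] at hw
          simpa using h (a :: w) (by simp; omega)
        · simp; omega

/-- A linear map out of `ℌ` that is multiplicative for the shuffle product. -/
def IsShuffleChar (φ : H →ₗ[ℚ] ℚ⟦X⟧) : Prop :=
  ∀ u v : List (Fin 2),
    φ (shuffle u v) = φ (Finsupp.single u 1) * φ (Finsupp.single v 1)

theorem IsShuffleChar.map_shuffleBilin {φ : H →ₗ[ℚ] ℚ⟦X⟧} (hφ : IsShuffleChar φ) (x y : H) :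
    φ (shuffleBilin x y) = φ x * φ y := by
  have h : shuffleBilin.compr₂ φ = (LinearMap.mul ℚ ℚ⟦X⟧).compl₁₂ φ φ := by
    ext u v : 4
    simpa using hφ u v
  exact LinearMap.congr_fun (LinearMap.congr_fun h x) y

/-- The counit, which maps the empty word to `1` and all the other words to `0`. -/
def counit : H →ₗ[ℚ] ℚ⟦X⟧ :=
  Finsupp.linearCombination ℚ fun w : List (Fin 2) => if w = [] then 1 else 0

theorem counit_prepend (a : Fin 2) (x : H) : counit (prepend a x) = 0 := by
  have h : counit ∘ₗ prepend a = 0 := by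
    ext w : 2
    simp [counit]
  exact LinearMap.congr_fun h x

theorem isShuffleChar_counit : IsShuffleChar counit := by
  rintro (_ | ⟨a, u⟩) (_ | ⟨b, v⟩)
  · simp [counit]
  · simp [counit]
  · simp [counit]
  · rw [shuffle, map_add, counit_prepend, counit_prepend]
    simp [counit]

/-- The product of the character `exp (c a)`, for a letter `a`, with `φ`. -/
def expMap (c : ℚ⟦X⟧) (a : Fin 2) (φ : H →ₗ[ℚ] ℚ⟦X⟧) : H →ₗ[ℚ] ℚ⟦X⟧ :=
  Finsupp.linearCombination ℚ fun w : List (Fin 2) =>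
    ∑ i ∈ Finset.range (w.length + 1), c ^ i * φ (unprependPow a i (Finsupp.single w 1))

theorem expMap_single (c : ℚ⟦X⟧) (a : Fin 2) (φ : H →ₗ[ℚ] ℚ⟦X⟧) (w : List (Fin 2)) {K : ℕ}
    (hK : w.length < K) :
    expMap c a φ (Finsupp.single w 1) =
      ∑ i ∈ Finset.range K, c ^ i * φ (unprependPow a i (Finsupp.single w 1)) := by
  rw [expMap, Finsupp.linearCombination_single, one_smul]
  refine Finset.sum_subset (Finset.range_subset_range.2 hK) fun i _ hi => ?_
  rw [unprependPow_single_of_lt a w i (by simpa using hi), map_zero, mul_zero]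

theorem IsShuffleChar.expMap {φ : H →ₗ[ℚ] ℚ⟦X⟧} (hφ : IsShuffleChar φ) (c : ℚ⟦X⟧) (a : Fin 2) :
    IsShuffleChar (expMap c a φ) := by
  intro u v
  set K := u.length + v.length + 1 with hK
  have h1 : QMZV.expMap c a φ (shuffle u v) =
      ∑ i ∈ Finset.range K, c ^ i * φ (unprependPow a i (shuffle u v)) := by
    have := eq_zero_on_shuffle u v
      (QMZV.expMap c a φ - ∑ i ∈ Finset.range K, c ^ i • (φ ∘ₗ unprependPow a i)) fun w hw => by
        rw [LinearMap.sub_apply, expMap_single c a φ w (show w.length < K by omega)]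
        simp
    simpa [sub_eq_zero] using this
  have h2 : ∀ n, c ^ n * φ (unprependPow a n (shuffle u v)) =
      ∑ p ∈ Finset.HasAntidiagonal.antidiagonal n,
        (c ^ p.1 * φ (unprependPow a p.1 (Finsupp.single u 1))) *
          (c ^ p.2 * φ (unprependPow a p.2 (Finsupp.single v 1))) := by
    intro n
    rw [← shuffleBilin_single, unprependPow_shuffleBilin, map_sum, Finset.mul_sum]
    refine Finset.sum_congr rfl fun p hp => ?_
    obtain rfl := Finset.HasAntidiagonal.mem_antidiagonal.1 hp
    rw [hφ.map_shuffleBilin]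
    ring
  rw [h1, Finset.sum_congr rfl fun n _ => h2 n,
    expMap_single c a φ u (show u.length < u.length + 1 by omega),
    expMap_single c a φ v (show v.length < v.length + 1 by omega), Finset.sum_mul_sum,
    ← Finset.sum_product', Finset.sum_sigma']
  symm
  -- The rectangle of exponents and the union of antidiagonals differ only in pairs that strip more
  -- letters than a factor has; these terms vanish.
  refine Finset.sum_bij_ne_zero (fun p _ _ => ⟨p.1 + p.2, p⟩) ?_ ?_ ?_ ?_
  · intro p hp _
    simp only [Finset.mem_product, Finset.mem_range] at hp
    simp only [Finset.mem_sigma, Finset.mem_range, Finset.HasAntidiagonal.mem_antidiagonal, and_true]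
    omega
  · rintro p _ _ p' _ _ h
    simpa using (Sigma.mk.inj h).2
  · rintro ⟨n, p⟩ hp h0
    simp only [Finset.mem_sigma, Finset.HasAntidiagonal.mem_antidiagonal] at hp
    refine ⟨p, ?_, h0, by rw [hp.2]⟩
    simp only [Finset.mem_product, Finset.mem_range]
    constructor
    · by_contra hlt
      exact h0 (by simp [unprependPow_single_of_lt a u p.1 (by omega)])
    · by_contra hlt
      exact h0 (by simp [unprependPow_single_of_lt a v p.2 (by omega)])
  · intro p _ _
    rfl

/-- The character `exp(e₀) exp(u_{N-1} e₁) ⋯ exp(e₀) exp(u₀ e₁)`, where `u_d = q^d / (1 - q^d)`. -/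
def pathChar : ℕ → H →ₗ[ℚ] ℚ⟦X⟧
  | 0 => counit
  | N + 1 => expMap 1 0 (expMap (qFrac N) 1 (pathChar N))

theorem isShuffleChar_pathChar (N : ℕ) : IsShuffleChar (pathChar N) := by
  induction N with
  | zero => exact isShuffleChar_counit
  | succ N ih => exact (ih.expMap _ _).expMap _ _

/-! ### Coefficients of the path character -/

/-- If the list `ks` starts with `i` ones followed by a letter `k`, apply `g` to `k - 1` and the
rest of the list. -/
def peel {R : Type*} [Zero R] (g : ℕ → List ℕ+ → R) : ℕ → List ℕ+ → R
  | _, [] => 0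
  | 0, k :: ks => g ((k : ℕ) - 1) ks
  | i + 1, k :: ks => if k = 1 then peel g i ks else 0

theorem peel_of_length_le {R : Type*} [Zero R] (g : ℕ → List ℕ+ → R) (i : ℕ) (ks : List ℕ+)
    (h : ks.length ≤ i) : peel g i ks = 0 := by
  induction ks generalizing i with
  | nil => cases i <;> rfl
  | cons k ks ih =>
    cases i with
    | zero => simp at h
    | succ i => simp [peel, ih i (by simpa using h)]

/-- The coefficient of `pathChar N` at `e₀ ^ j` times a word of `ℌ¹`. -/
def pathCoeff (N j : ℕ) (ks : List ℕ+) : ℚ⟦X⟧ :=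
  pathChar N (Finsupp.single (List.replicate j 0 ++ toWord ks) 1)

/-- The contribution to the generating series of all blocks of summation indices equal to `N`. -/
def blockSum (N : ℕ) (g : ℕ → List ℕ+ → ℚ⟦X⟧) (ks : List ℕ+) : ℚ⟦X⟧ :=
  ∑ i ∈ Finset.range ks.length, (1 / ((i + 1).factorial : ℚ)) • (qFrac N ^ (i + 1) * peel g i ks)

@[simp]
theorem blockSum_nil (N : ℕ) (g : ℕ → List ℕ+ → ℚ⟦X⟧) : blockSum N g [] = 0 := by
  simp [blockSum]

theorem unprepend_zero_toWord (ks : List ℕ+) :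
    unprepend 0 (Finsupp.single (toWord ks) 1) = 0 := by
  cases ks <;> simp [toWord]

theorem unprepend_pow_zero_replicate (i j : ℕ) (w : List (Fin 2)) :
    (unprepend 0 ^ i) (Finsupp.single (List.replicate (j + i) 0 ++ w) 1) =
      Finsupp.single (List.replicate j 0 ++ w) 1 := by
  induction i with
  | zero => simp
  | succ i ih =>
    rw [pow_succ, Module.End.mul_apply, ← add_assoc, List.replicate_succ, List.cons_append,
      unprepend_single_cons, if_pos rfl, ih]

theorem unprependPow_zero_of_le {i j : ℕ} (h : i ≤ j) (w : List (Fin 2)) :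
    unprependPow 0 i (Finsupp.single (List.replicate j 0 ++ w) 1) =
      (1 / (i.factorial : ℚ)) • Finsupp.single (List.replicate (j - i) 0 ++ w) 1 := by
  obtain ⟨m, rfl⟩ := Nat.exists_eq_add_of_le' h
  rw [unprependPow, LinearMap.smul_apply, unprepend_pow_zero_replicate, Nat.add_sub_cancel]

theorem unprependPow_zero_of_lt {i j : ℕ} (h : j < i) (ks : List ℕ+) :
    unprependPow 0 i (Finsupp.single (List.replicate j 0 ++ toWord ks) 1) = 0 := by
  obtain ⟨m, rfl⟩ := Nat.exists_eq_add_of_lt h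
  rw [unprependPow, LinearMap.smul_apply, show j + m + 1 = m + (1 + j) by omega, pow_add, pow_add,
    Module.End.mul_apply, Module.End.mul_apply]
  have := unprepend_pow_zero_replicate j 0 (toWord ks)
  rw [zero_add] at this
  rw [this]
  simp [unprepend_zero_toWord]

/-- Once `e_k` has lost its `e₁`, the next letter is `e₀` unless `k = 1`. So all stripped monomials
but the last must be `e₁`, and the last one leaves `e₀^(k-1)` in front of the rest. -/
theorem map_unprepend_pow_one (φ : H →ₗ[ℚ] ℚ⟦X⟧) (i : ℕ) (ks : List ℕ+) :
    φ ((unprepend 1 ^ (i + 1)) (Finsupp.single (toWord ks) 1)) =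
      peel (fun j ls => φ (Finsupp.single (List.replicate j 0 ++ toWord ls) 1)) i ks := by
  induction i generalizing ks with
  | zero => cases ks <;> simp [toWord, peel]
  | succ i ih =>
    rw [pow_succ, Module.End.mul_apply]
    cases ks with
    | nil => simp [toWord, peel]
    | cons k ks =>
      simp only [toWord, unprepend_single_cons, if_true, peel]
      split_ifs with hk
      · subst hk
        simpa using ih ks
      · have h1 : 1 ≤ (k : ℕ) - 1 := by
          have h2 : (k : ℕ) ≠ 1 := fun h => hk (PNat.eq h)
          have := k.pos
          omega
        obtain ⟨m, hm⟩ := Nat.exists_eq_add_of_le' h1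
        rw [hm, pow_succ, Module.End.mul_apply]
        simp [List.replicate_succ]

theorem length_le_length_toWord (ks : List ℕ+) : ks.length ≤ (toWord ks).length := by
  induction ks with
  | nil => simp
  | cons k ks ih => simp [toWord]; omega

theorem expMap_one_toWord (N : ℕ) (ks : List ℕ+) :
    expMap (qFrac N) 1 (pathChar N) (Finsupp.single (toWord ks) 1) =
      pathCoeff N 0 ks + blockSum N (pathCoeff N) ks := by
  rw [expMap_single _ _ _ _ (Nat.lt_succ_self _), Finset.sum_range_succ', add_comm]
  congr 1
  · simp [pathCoeff, unprependPow]
  · rw [blockSum]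
    symm
    refine Finset.sum_subset_zero_on_sdiff
      (Finset.range_subset_range.2 (length_le_length_toWord ks)) (fun i hi => ?_) fun i _ => ?_
    · rw [unprependPow, LinearMap.smul_apply, map_smul, map_unprepend_pow_one, peel_of_length_le]
      · simp
      · simp only [Finset.mem_sdiff, Finset.mem_range, not_lt] at hi
        exact hi.2
    · rw [unprependPow, LinearMap.smul_apply, map_smul, map_unprepend_pow_one, mul_smul_comm]
      rfl

theorem expMap_one_zero_cons (N : ℕ) (w : List (Fin 2)) :
    expMap (qFrac N) 1 (pathChar N) (Finsupp.single (0 :: w) 1) =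
      pathChar N (Finsupp.single (0 :: w) 1) := by
  rw [expMap_single _ _ _ _ (Nat.lt_succ_self _), Finset.sum_range_succ', Finset.sum_eq_zero]
  · simp [unprependPow]
  · intro i _
    rw [unprependPow, LinearMap.smul_apply, pow_succ (unprepend 1), Module.End.mul_apply]
    simp

/-- The factor `exp(e₀)` strips `i` letters `e₀`. If `i < j`, the rest starts with `e₀` and `exp(u_N
e₁)` acts trivially; only `i = j` lets a block with index `N` begin. -/
theorem pathCoeff_succ (N j : ℕ) (ks : List ℕ+) :
    pathCoeff (N + 1) j ks =
      ∑ i ∈ Finset.range (j + 1), (1 / (i.factorial : ℚ)) • pathCoeff N (j - i) ks +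
        (1 / (j.factorial : ℚ)) • blockSum N (pathCoeff N) ks := by
  rw [pathCoeff, pathChar, expMap_single (K := j + 1 + ((toWord ks).length)) _ _ _ _
    (by simp)]
  have h1 : ∀ i ∈ Finset.range (j + 1 + (toWord ks).length), i ∉ Finset.range (j + 1) →
      1 ^ i * expMap (qFrac N) 1 (pathChar N)
        (unprependPow 0 i (Finsupp.single (List.replicate j 0 ++ toWord ks) 1)) = 0 := by
    intro i _ hi
    rw [unprependPow_zero_of_lt (by simpa using hi)]
    simp
  rw [← Finset.sum_subset (Finset.range_subset_range.2 (Nat.le_add_right _ _)) h1,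
    Finset.sum_range_succ, Finset.sum_range_succ, add_assoc]
  congr 1
  · refine Finset.sum_congr rfl fun i hi => ?_
    rw [Finset.mem_range] at hi
    obtain ⟨m, hm⟩ := Nat.exists_eq_add_of_lt hi
    rw [unprependPow_zero_of_le hi.le, map_smul, one_pow, one_mul, pathCoeff,
      show j - i = m + 1 by omega, List.replicate_succ, List.cons_append, expMap_one_zero_cons]
  · rw [unprependPow_zero_of_le le_rfl, map_smul, Nat.sub_self, List.replicate_zero,
      List.nil_append, expMap_one_toWord, smul_add, one_pow, one_mul]

/-- The divided power `a ^ j / j!`. -/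
def dpow (j a : ℕ) : ℚ := (a : ℚ) ^ j / (j.factorial : ℚ)

theorem dpow_zero_right (j : ℕ) : dpow j 0 = if j = 0 then 1 else 0 := by
  cases j <;> simp [dpow]

theorem dpow_one (j : ℕ) : dpow j 1 = 1 / (j.factorial : ℚ) := by simp [dpow]

theorem dpow_add_one (j a : ℕ) :
    dpow j (a + 1) = ∑ i ∈ Finset.range (j + 1), (1 / (i.factorial : ℚ)) * dpow (j - i) a := by
  rw [dpow, Nat.cast_add_one, add_comm (a : ℚ), add_pow, Finset.sum_div]
  refine Finset.sum_congr rfl fun i hi => ?_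
  have hi' : i ≤ j := by simpa [Nat.lt_succ_iff] using hi
  rw [dpow, one_pow, one_mul, Nat.cast_choose ℚ hi']
  have := Nat.factorial_ne_zero j
  field_simp

/-- The recursion unrolled: `δ` is the largest index that carries an `e₁`, and the `j` leading
letters `e₀` come from the `N - δ` factors `exp(e₀)` to its left. -/
theorem pathCoeff_eq (N j : ℕ) (ks : List ℕ+) :
    pathCoeff N j ks = (if ks = [] then dpow j N else 0) • (1 : ℚ⟦X⟧) +
      ∑ δ ∈ Finset.range N, dpow j (N - δ) • blockSum δ (pathCoeff δ) ks := by
  induction N generalizing j with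
  | zero =>
    rw [pathCoeff, pathChar, counit, Finsupp.linearCombination_single]
    rcases ks with _ | ⟨k, ks⟩
    · by_cases h : j = 0 <;> simp [toWord, h, dpow_zero_right]
    · simp [toWord]
  | succ N ih =>
    have h1 : ∀ δ ∈ Finset.range N, dpow j (N + 1 - δ) • blockSum δ (pathCoeff δ) ks =
        ∑ i ∈ Finset.range (j + 1), (1 / (i.factorial : ℚ)) •
          (dpow (j - i) (N - δ) • blockSum δ (pathCoeff δ) ks) := by
      intro δ hδ
      rw [Finset.mem_range] at hδ
      rw [Nat.sub_add_comm hδ.le, dpow_add_one, Finset.sum_smul]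
      exact Finset.sum_congr rfl fun i _ => by rw [smul_smul]
    rw [pathCoeff_succ, Finset.sum_range_succ _ N, Finset.sum_congr rfl h1, Finset.sum_comm,
      ← add_assoc]
    congr 1
    · simp_rw [ih, smul_add, Finset.sum_add_distrib, Finset.smul_sum]
      congr 1
      simp_rw [smul_smul, ← Finset.sum_smul]
      split_ifs
      · rw [dpow_add_one]
      · simp
    · rw [Nat.add_sub_cancel_left, dpow_one]

/-! ### Coefficients of the exponentials in `T_ш` -/

theorem expSeries_add {r : ℕ} {Y Z : GenSeries r} (hY : MvPowerSeries.constantCoeff Y = 0)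
    (hZ : MvPowerSeries.constantCoeff Z = 0) :
    expSeries (Y + Z) = expSeries Y * expSeries Z := by
  let X0 : MvPowerSeries (Fin 2) ℚ := MvPowerSeries.X 0
  let X1 : MvPowerSeries (Fin 2) ℚ := MvPowerSeries.X 1
  -- The functional equation is checked for two universal variables, where coefficients are
  -- explicit, and then specialised to `Y` and `Z`.
  have h : (PowerSeries.exp ℚ).subst (X0 + X1) =
      (PowerSeries.exp ℚ).subst X0 * (PowerSeries.exp ℚ).subst X1 := by
    ext e
    rw [PowerSeries.coeff_subst_X_zero_add_X_one, PowerSeries.coeff_subst_X_zero_subst_mul_X_one]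
    simp only [PowerSeries.coeff_exp]
    rw [Nat.cast_add_choose]
    have := Nat.factorial_ne_zero (e 0 + e 1)
    simp
    field_simp
  have hs : MvPowerSeries.HasSubst (![Y, Z] : Fin 2 → GenSeries r) :=
    MvPowerSeries.hasSubst_of_constantCoeff_zero fun i => by fin_cases i <;> simp [hY, hZ]
  have hX0 : PowerSeries.HasSubst X0 := PowerSeries.HasSubst.X 0
  have hX1 : PowerSeries.HasSubst X1 := PowerSeries.HasSubst.X 1
  have key : ∀ W : MvPowerSeries (Fin 2) ℚ, PowerSeries.HasSubst W →
      MvPowerSeries.subst (![Y, Z] : Fin 2 → GenSeries r) ((PowerSeries.exp ℚ).subst W) =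
        expSeries (MvPowerSeries.subst ![Y, Z] W) := by
    intro W hW
    rw [expSeries, PowerSeries.subst, MvPowerSeries.subst_comp_subst_apply hW.const hs]
    rfl
  have h2 := congrArg (MvPowerSeries.subst (![Y, Z] : Fin 2 → GenSeries r)) h
  rw [MvPowerSeries.subst_mul hs, key _ (hX0.add hX1), key _ hX0, key _ hX1,
    MvPowerSeries.subst_add hs, MvPowerSeries.subst_X hs, MvPowerSeries.subst_X hs] at h2
  simpa using h2

theorem expSeries_zero {r : ℕ} : expSeries (0 : GenSeries r) = 1 := by
  rw [expSeries, PowerSeries.subst_zero_eq_C_constantCoeff]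
  simp

theorem expSeries_sum {r : ℕ} {ι : Type*} (s : Finset ι) (Y : ι → GenSeries r)
    (hY : ∀ i, MvPowerSeries.constantCoeff (Y i) = 0) :
    expSeries (∑ i ∈ s, Y i) = ∏ i ∈ s, expSeries (Y i) := by
  classical
  induction s using Finset.induction_on with
  | empty => simp [expSeries_zero]
  | insert i s hi ih =>
    rw [Finset.sum_insert hi, Finset.prod_insert hi, expSeries_add (hY i) (by simp [hY]), ih]

theorem coeff_expSeries_linear {r : ℕ} (a : Fin r → ℚ) (e : Fin r →₀ ℕ) :
    MvPowerSeries.coeff e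
        (expSeries (∑ j, MvPowerSeries.C (PowerSeries.C (a j)) * MvPowerSeries.X j)) =
      PowerSeries.C (∏ j, a j ^ e j / ((e j).factorial : ℚ)) := by
  have hs : PowerSeries.HasSubst
      (∑ j, MvPowerSeries.C (PowerSeries.C (a j)) * MvPowerSeries.X j : GenSeries r) :=
    PowerSeries.HasSubst.of_constantCoeff_zero (by simp)
  have hp : ∀ n, MvPowerSeries.coeff e
      ((∑ j, MvPowerSeries.C (PowerSeries.C (a j)) * MvPowerSeries.X j : GenSeries r) ^ n) =
      if e.sum (fun _ m => m) = n then
        (e.multinomial : ℚ⟦X⟧) * e.prod (fun j m => PowerSeries.C (a j) ^ m) else 0 := by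
    intro n
    rw [← MvPolynomial.coeff_linearCombination_X_pow_of_fintype (fun j => PowerSeries.C (a j)) e n,
      ← MvPolynomial.coeff_coe]
    congr 1
    rw [MvPolynomial.coe_pow]
    congr 1
    rw [← MvPolynomial.coeToMvPowerSeries.ringHom_apply, map_sum]
    refine Finset.sum_congr rfl fun j _ => ?_
    rw [MvPolynomial.smul_eq_C_mul, map_mul, MvPolynomial.coeToMvPowerSeries.ringHom_apply,
      MvPolynomial.coeToMvPowerSeries.ringHom_apply, MvPolynomial.coe_C, MvPolynomial.coe_X]
  rw [expSeries, PowerSeries.coeff_subst hs, finsum_eq_single _ (e.sum fun _ m => m)]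
  · rw [hp, if_pos rfl]
    have hm : (e.multinomial : ℚ) =
        ((∑ j, e j).factorial : ℚ) / ∏ j, ((e j).factorial : ℚ) := by
      rw [Finsupp.multinomial_eq_of_support_subset (Finset.subset_univ _)]
      have h0 : (∏ j, ((e j).factorial : ℚ)) ≠ 0 :=
        Finset.prod_ne_zero_iff.2 fun j _ => Nat.cast_ne_zero.2 (Nat.factorial_ne_zero _)
      rw [eq_div_iff h0, mul_comm]
      exact_mod_cast Nat.multinomial_spec Finset.univ e
    have hsum : (e.sum fun _ m => m) = ∑ j, e j := Finsupp.sum_fintype _ _ fun _ => rfl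
    rw [Finsupp.prod_fintype _ _ fun _ => pow_zero _, hsum, PowerSeries.coeff_exp,
      PowerSeries.smul_eq_C_mul, Finset.prod_div_distrib]
    have hc : (e.multinomial : ℚ⟦X⟧) = PowerSeries.C (e.multinomial : ℚ) := by simp
    simp_rw [hc, ← map_pow]
    rw [← map_prod, ← map_mul, ← map_mul, hm]
    congr 1
    have h1 := Nat.factorial_ne_zero (∑ j, e j)
    simp
    field_simp
  · intro n hn
    rw [hp, if_neg hn.symm, smul_zero]

/-- The sum of the entries of `n` from the index `l` on. -/
def tailSum {m : ℕ} (n : Fin m → ℕ) (l : ℕ) : ℕ :=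
  ∑ i : Fin m, if l ≤ (i : ℕ) then n i else 0

theorem tailSum_self {m : ℕ} (n : Fin m → ℕ) : tailSum n m = 0 :=
  Finset.sum_eq_zero fun i _ => if_neg (by omega)

theorem tailSum_zero {m : ℕ} (n : Fin m → ℕ) : tailSum n 0 = ∑ i, n i := by simp [tailSum]

theorem tailSum_le {m : ℕ} (n : Fin m → ℕ) (l : ℕ) : tailSum n l ≤ ∑ i, n i :=
  Finset.sum_le_sum fun i _ => by split_ifs <;> simp

theorem tailSum_snoc {m : ℕ} (n : Fin m → ℕ) (b l : ℕ) (hl : l ≤ m) :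
    tailSum (Fin.snoc n b : Fin (m + 1) → ℕ) l = tailSum n l + b := by
  simp [tailSum, Fin.sum_univ_castSucc, hl]

/-- The coefficient of `X_p` in `∑ d_l Y_l`, where `Y_l = X_{n_l + ⋯ + n_m} - X_{n_{l+1} + ⋯ + n_m}`
(for `p = 0` the variable `X_0` is not put to zero here). -/
def varCoeff {m : ℕ} (n d : Fin m → ℕ) (p : ℤ) : ℚ :=
  ∑ l : Fin m, (d l : ℚ) *
    ((if (tailSum n l : ℤ) = p then 1 else 0) - if (tailSum n (l + 1) : ℤ) = p then 1 else 0)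

/-- A new largest index `δ` with block length `b` contributes `δ (X_b - X_0)` and shifts the
variables of the older blocks by `b`. Integer `p` allows the shift to become negative. -/
theorem varCoeff_snoc {m : ℕ} (n d : Fin m → ℕ) (b δ : ℕ) (p : ℤ) :
    varCoeff (Fin.snoc n b : Fin (m + 1) → ℕ) (Fin.snoc d δ : Fin (m + 1) → ℕ) p =
      varCoeff n d (p - b) + δ * ((if (b : ℤ) = p then 1 else 0) - if p = 0 then 1 else 0) := by
  rw [varCoeff, Fin.sum_univ_castSucc, varCoeff]
  congr 1
  · refine Finset.sum_congr rfl fun l _ => ?_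
    rw [Fin.snoc_castSucc, Fin.val_castSucc, tailSum_snoc _ _ _ (by omega),
      tailSum_snoc _ _ _ (by omega)]
    simp only [Nat.cast_add, eq_sub_iff_add_eq]
  · rw [Fin.snoc_last, Fin.val_last, tailSum_snoc _ _ _ le_rfl, tailSum_self, tailSum_self]
    simp [eq_comm]

theorem varCoeff_of_neg {m : ℕ} (n d : Fin m → ℕ) {p : ℤ} (hp : p < 0) : varCoeff n d p = 0 :=
  Finset.sum_eq_zero fun l _ => by
    rw [if_neg (by omega), if_neg (by omega), sub_zero, mul_zero]

theorem xVar_eq_sum {r s : ℕ} (hs : s ≤ r) :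
    xVar r s = ∑ j : Fin r, if (s : ℤ) = (j : ℕ) + 1 then MvPowerSeries.X j else 0 := by
  rw [xVar]
  split_ifs with h
  · rw [Finset.sum_eq_single ⟨s - 1, by omega⟩]
    · rw [if_pos]
      simp only
      omega
    · intro j _ hj
      refine if_neg fun h' => hj (Fin.ext ?_)
      simp only
      omega
    · simp
  · symm
    refine Finset.sum_eq_zero fun j _ => if_neg ?_
    omega

theorem constantCoeff_xVar (r s : ℕ) : MvPowerSeries.constantCoeff (xVar r s) = 0 := by
  rw [xVar]
  split_ifs <;> simp

theorem sum_mul_xVar_sub {r m : ℕ} (n d : Fin m → ℕ) (hn : ∑ i, n i = r) :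
    ∑ l : Fin m, (d l : GenSeries r) * (xVar r (tailSum n l) - xVar r (tailSum n (l + 1))) =
      ∑ j : Fin r, MvPowerSeries.C (PowerSeries.C (varCoeff n d ((j : ℕ) + 1))) *
        MvPowerSeries.X j := by
  simp_rw [varCoeff, map_sum, Finset.sum_mul]
  rw [Finset.sum_comm]
  refine Finset.sum_congr rfl fun l _ => ?_
  rw [xVar_eq_sum ((tailSum_le n l).trans hn.le), xVar_eq_sum ((tailSum_le n _).trans hn.le),
    ← Finset.sum_sub_distrib, Finset.mul_sum]
  refine Finset.sum_congr rfl fun j _ => ?_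
  rw [map_mul, map_mul, map_natCast, map_natCast, mul_assoc]
  congr 1
  split_ifs <;> simp

/-- The product of the divided powers `a_p ^ (k_p - 1) / (k_p - 1)!`, where the positions of the
list `[k_0, k_1, …]` are counted from `0`. -/
def dpowProd (a : ℕ → ℚ) : List ℕ+ → ℚ
  | [] => 1
  | k :: ks => a 0 ^ ((k : ℕ) - 1) / (((k : ℕ) - 1).factorial : ℚ) * dpowProd (fun p => a (p + 1)) ks

theorem prod_eq_dpowProd (a : ℕ → ℚ) (ks : List ℕ+) :
    ∏ j : Fin ks.length, a j ^ ((ks.get j : ℕ) - 1) / (((ks.get j : ℕ) - 1).factorial : ℚ) =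
      dpowProd a ks := by
  induction ks generalizing a with
  | nil => simp [dpowProd]
  | cons k ks ih =>
    rw [dpowProd, ← ih]
    exact Fin.prod_univ_succ _

/-- A zero `a_p` contributes `0^(k_p - 1)`, which is `1` if `k_p = 1` and `0` otherwise: the
constraint built into `peel`. -/
theorem dpowProd_eq_peel (a : ℕ → ℚ) (i : ℕ) (ks : List ℕ+) (hi : i < ks.length)
    (h : ∀ p < i, a p = 0) :
    dpowProd a ks = peel (fun j ls => a i ^ j / (j.factorial : ℚ) *
      dpowProd (fun p => a (p + (i + 1))) ls) i ks := by
  induction i generalizing a ks with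
  | zero =>
    cases ks with
    | nil => simp at hi
    | cons k ks => simp [dpowProd, peel]
  | succ i ih =>
    cases ks with
    | nil => simp at hi
    | cons k ks =>
      rw [dpowProd, h 0 (Nat.succ_pos i), peel,
        ih (fun p => a (p + 1)) ks (by simpa using hi) fun p hp => h (p + 1) (by omega)]
      split_ifs with hk
      · subst hk
        simp [add_assoc]
      · have h2 : (k : ℕ) - 1 ≠ 0 := by
          have h2 : (k : ℕ) ≠ 1 := fun h => hk (PNat.eq h)
          have := k.pos
          omega
        simp [h2]

theorem coeff_hTerm {m : ℕ} (ks : List ℕ+) (n d : Fin m → ℕ) (hn : ∑ i, n i = ks.length) :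
    MvPowerSeries.coeff
        (Finsupp.equivFunOnFinite.symm fun j : Fin ks.length => (ks.get j : ℕ) - 1)
        (hTerm n (fun l => xVar ks.length (tailSum n l) - xVar ks.length (tailSum n (l + 1))) d) =
      dpowProd (fun p => varCoeff n d (p + 1)) ks • ∏ i, qFrac (d i) ^ n i := by
  rw [hTerm, Finset.prod_mul_distrib, ← expSeries_sum _ _ fun l => by
    rw [map_mul, map_sub, constantCoeff_xVar, constantCoeff_xVar, sub_zero, mul_zero],
    sum_mul_xVar_sub n d hn, ← map_prod, MvPowerSeries.coeff_mul_C, coeff_expSeries_linear,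
    ← PowerSeries.smul_eq_C_mul]
  congr 1
  rw [← prod_eq_dpowProd]
  rfl

/-! ### The sums over compositions -/

theorem peel_congr {R : Type*} [Zero R] {g g' : ℕ → List ℕ+ → R} (i : ℕ) (ks : List ℕ+)
    (h : ∀ j ls, ls.length + (i + 1) = ks.length → g j ls = g' j ls) :
    peel g i ks = peel g' i ks := by
  induction i generalizing ks with
  | zero =>
    cases ks with
    | nil => rfl
    | cons k ks => exact h _ _ (by simp)
  | succ i ih =>
    cases ks with
    | nil => rfl
    | cons k ks =>
      rw [peel, peel, ih ks fun j ls hl => h j ls (by rw [List.length_cons]; omega)]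

theorem map_peel {R S F : Type*} [Zero R] [Zero S] [FunLike F R S] [ZeroHomClass F R S] (f : F)
    (g : ℕ → List ℕ+ → R) (i : ℕ) (ks : List ℕ+) :
    f (peel g i ks) = peel (fun j ls => f (g j ls)) i ks := by
  induction i generalizing ks with
  | zero => cases ks <;> simp [peel]
  | succ i ih =>
    cases ks with
    | nil => simp [peel]
    | cons k ks =>
      rw [peel, peel, ← ih]
      split_ifs <;> simp

theorem peel_sum {R ι : Type*} [AddCommMonoid R] (s : Finset ι) (g : ι → ℕ → List ℕ+ → R) (i : ℕ)
    (ks : List ℕ+) :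
    peel (fun j ls => ∑ x ∈ s, g x j ls) i ks = ∑ x ∈ s, peel (g x) i ks := by
  induction i generalizing ks with
  | zero => cases ks <;> simp [peel]
  | succ i ih =>
    cases ks with
    | nil => simp [peel]
    | cons k ks =>
      rw [peel, ih]
      simp only [peel]
      split_ifs <;> simp

/-- The strictly increasing sequences of length `m` with entries below `L`. -/
def strictSeqs (m L : ℕ) : Finset (Fin m → ℕ) := by
  classical
  exact (Fintype.piFinset fun _ => Finset.range L).filter StrictMono

theorem mem_strictSeqs {m L : ℕ} {d : Fin m → ℕ} :
    d ∈ strictSeqs m L ↔ (∀ i, d i < L) ∧ StrictMono d := by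
  simp [strictSeqs]

theorem snoc_mem_strictSeqs {m L δ : ℕ} {d : Fin m → ℕ} :
    (Fin.snoc d δ : Fin (m + 1) → ℕ) ∈ strictSeqs (m + 1) L ↔
      δ < L ∧ d ∈ strictSeqs m δ := by
  rw [mem_strictSeqs, mem_strictSeqs]
  constructor
  · rintro ⟨h1, h2⟩
    refine ⟨by simpa using h1 (Fin.last m), fun i => ?_, fun i j hij => ?_⟩
    · simpa using h2 (Fin.castSucc_lt_last i)
    · simpa using h2 (Fin.castSucc_lt_castSucc_iff.2 hij)
  · rintro ⟨h1, h2, h3⟩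
    constructor
    · intro i
      induction i using Fin.lastCases with
      | last => simpa using h1
      | cast i => simpa using (h2 i).trans h1
    · intro i j hij
      induction j using Fin.lastCases with
      | last =>
        induction i using Fin.lastCases with
        | last => exact absurd hij (lt_irrefl _)
        | cast i => simpa using h2 i
      | cast j =>
        induction i using Fin.lastCases with
        | last => exact absurd hij (not_lt.2 (Fin.le_last _))
        | cast i => simpa using h3 (Fin.castSucc_lt_castSucc_iff.1 hij)

theorem sum_strictSeqs_succ {R : Type*} [AddCommMonoid R] (m L : ℕ) (F : (Fin (m + 1) → ℕ) → R) :
    ∑ d ∈ strictSeqs (m + 1) L, F d =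
      ∑ δ ∈ Finset.range L, ∑ d ∈ strictSeqs m δ, F (Fin.snoc d δ : Fin (m + 1) → ℕ) := by
  rw [Finset.sum_sigma']
  refine Finset.sum_bij' (fun d _ => ⟨d (Fin.last m), Fin.init d⟩)
    (fun p _ => (Fin.snoc p.2 p.1 : Fin (m + 1) → ℕ)) ?_ ?_ ?_ ?_ ?_
  · intro d hd
    rw [← Fin.snoc_init_self d, snoc_mem_strictSeqs] at hd
    simpa using hd
  · rintro ⟨δ, d⟩ h
    rw [snoc_mem_strictSeqs]
    simpa using h
  · intro d _
    exact Fin.snoc_init_self d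
  · rintro ⟨δ, d⟩ _
    simp
  · intro d _
    simp only [Fin.snoc_init_self]

/-- The sum over `d₁ < ⋯ < d_m < L` with prescribed block lengths `bs = [i_m, …, i₁]`. -/
def chainSum : List ℕ → ℕ → ℕ → List ℕ+ → ℚ⟦X⟧
  | [], L, j, _ => dpow j L • 1
  | b :: bs, L, j, ks => ∑ δ ∈ Finset.range L, dpow j (L - δ) • (1 / (b.factorial : ℚ)) •
      (qFrac δ ^ b * peel (chainSum bs δ) (b - 1) ks)

/-- Induction that removes the largest index `δ`. Its block takes the first `b` letters: `X_1, …,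
X_{b-1}` do not occur, and `X_b` has coefficient `δ + varCoeff n d 0`, the gap down to the next
index. Keeping `X_0` as a variable gives this gap the same shape as `L + varCoeff n d 0`, so the
induction hypothesis applies with `L` replaced by `δ`. -/
theorem sum_strictSeqs_eq_chainSum {m : ℕ} (n : Fin m → ℕ) (hn : ∀ i, 1 ≤ n i) (L j : ℕ)
    (ks : List ℕ+) (hks : ∑ i, n i = ks.length) :
    (1 / ∏ i, ((n i).factorial : ℚ)) • ∑ d ∈ strictSeqs m L,
      ((L + varCoeff n d 0) ^ j / (j.factorial : ℚ)) •
        dpowProd (fun p => varCoeff n d (p + 1)) ks • ∏ i, qFrac (d i) ^ n i =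
      chainSum (List.ofFn n).reverse L j ks := by
  induction m generalizing L j ks with
  | zero =>
    have hS : strictSeqs 0 L = {Fin.elim0} := by
      ext d
      rw [mem_strictSeqs, Finset.mem_singleton]
      exact ⟨fun _ => Subsingleton.elim _ _, fun _ => ⟨fun i => i.elim0, fun i => i.elim0⟩⟩
    have hk : ks = [] := by
      rw [Finset.univ_eq_empty, Finset.sum_empty] at hks
      exact List.eq_nil_of_length_eq_zero hks.symm
    rw [hS, hk]
    simp [chainSum, varCoeff, dpowProd, dpow]
  | succ m ih =>
    obtain ⟨n, b, rfl⟩ : ∃ n' b, n = (Fin.snoc n' b : Fin (m + 1) → ℕ) :=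
      ⟨_, _, (Fin.snoc_init_self n).symm⟩
    have hn' : ∀ i, 1 ≤ n i := fun i => by simpa using hn i.castSucc
    have hb : 1 ≤ b := by simpa using hn (Fin.last m)
    obtain ⟨c, rfl⟩ := Nat.exists_eq_add_of_le' hb
    rw [Fin.sum_univ_castSucc] at hks
    simp only [Fin.snoc_castSucc, Fin.snoc_last] at hks
    have hrev : (List.ofFn (Fin.snoc n (c + 1) : Fin (m + 1) → ℕ)).reverse =
        (c + 1) :: (List.ofFn n).reverse := by
      rw [List.ofFn_succ']
      simp
    rw [hrev, chainSum, sum_strictSeqs_succ, Finset.smul_sum]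
    refine Finset.sum_congr rfl fun δ hδ => ?_
    rw [Finset.mem_range] at hδ
    rw [Nat.add_sub_cancel]
    have hprod : ∀ d : Fin m → ℕ,
        dpowProd (fun p => varCoeff (Fin.snoc n (c + 1) : Fin (m + 1) → ℕ)
          (Fin.snoc d δ : Fin (m + 1) → ℕ) (p + 1)) ks =
        peel (fun j ls => (δ + varCoeff n d 0) ^ j / (j.factorial : ℚ) *
          dpowProd (fun p => varCoeff n d (p + 1)) ls) c ks := by
      intro d
      rw [dpowProd_eq_peel _ c ks (by omega)]
      · congr 1
        funext j ls
        congr 1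
        · rw [varCoeff_snoc, show ((c : ℤ) + 1 - ((c + 1 : ℕ) : ℤ)) = 0 by push_cast; ring,
            if_pos (by push_cast; ring), if_neg (by omega)]
          ring
        · congr 1
          funext p
          rw [varCoeff_snoc, if_neg (by push_cast; omega), if_neg (by push_cast; omega)]
          rw [sub_zero, mul_zero, add_zero]
          congr 1
          push_cast
          ring
      · intro p hp
        rw [varCoeff_snoc, varCoeff_of_neg _ _ (by push_cast; omega),
          if_neg (by push_cast; omega), if_neg (by omega)]
        simp
    have hzero : ∀ d : Fin m → ℕ, (L + varCoeff (Fin.snoc n (c + 1) : Fin (m + 1) → ℕ)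
          (Fin.snoc d δ : Fin (m + 1) → ℕ) 0) ^ j / (j.factorial : ℚ) = dpow j (L - δ) := by
      intro d
      rw [varCoeff_snoc, varCoeff_of_neg _ _ (by push_cast; omega), if_neg (by push_cast; omega),
        if_pos rfl, dpow, Nat.cast_sub hδ.le]
      ring
    have hpeel : peel (chainSum (List.ofFn n).reverse δ) c ks =
        peel (fun j ls => (1 / ∏ i, ((n i).factorial : ℚ)) • ∑ d ∈ strictSeqs m δ,
          ((δ + varCoeff n d 0) ^ j / (j.factorial : ℚ)) •
          dpowProd (fun p => varCoeff n d (p + 1)) ls • ∏ i, qFrac (d i) ^ n i) c ks :=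
      peel_congr c ks fun j ls hl => (ih n hn' δ j ls (by omega)).symm
    rw [hpeel]
    simp_rw [hzero, hprod, Fin.prod_univ_castSucc, Fin.snoc_castSucc, Fin.snoc_last,
      Finset.smul_sum]
    rw [peel_sum, Finset.mul_sum, Finset.smul_sum, Finset.smul_sum]
    refine Finset.sum_congr rfl fun d _ => ?_
    have hlin : peel (fun j ls => (1 / ∏ i, ((n i).factorial : ℚ)) •
          ((δ + varCoeff n d 0) ^ j / (j.factorial : ℚ)) •
          dpowProd (fun p => varCoeff n d (p + 1)) ls • ∏ i, qFrac (d i) ^ n i) c ks =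
        (1 / ∏ i, ((n i).factorial : ℚ)) • peel (fun j ls =>
          (δ + varCoeff n d 0) ^ j / (j.factorial : ℚ) *
          dpowProd (fun p => varCoeff n d (p + 1)) ls) c ks • ∏ i, qFrac (d i) ^ n i := by
      have h := map_peel ((1 / ∏ i, ((n i).factorial : ℚ)) •
        (LinearMap.toSpanSingleton ℚ ℚ⟦X⟧ (∏ i, qFrac (d i) ^ n i))) (fun j ls =>
          (δ + varCoeff n d 0) ^ j / (j.factorial : ℚ) *
          dpowProd (fun p => varCoeff n d (p + 1)) ls) c ks
      simp only [LinearMap.smul_apply, LinearMap.toSpanSingleton_apply, mul_smul] at h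
      exact h.symm
    rw [hlin]
    simp only [smul_smul, mul_smul_comm]
    rw [mul_comm (∏ i, qFrac (d i) ^ n i)]
    congr 1
    simp only [one_div, mul_inv]
    ring

theorem sum_composition_succ {R : Type*} [AddCommMonoid R] (r : ℕ) (hr : r ≠ 0)
    (F : List ℕ → R) :
    ∑ c : Composition r, F c.blocks =
      ∑ i ∈ Finset.range r, ∑ c : Composition (r - (i + 1)), F ((i + 1) :: c.blocks) := by
  rw [Finset.sum_sigma']
  symm
  refine Finset.sum_bij (fun p hp => ⟨(p.1 + 1) :: p.2.blocks, ?_, ?_⟩) ?_ ?_ ?_ ?_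
  · intro i hi
    rcases List.mem_cons.1 hi with rfl | hi
    · omega
    · exact p.2.blocks_pos hi
  · simp only [Finset.mem_sigma, Finset.mem_range, Finset.mem_univ, and_true] at hp
    rw [List.sum_cons, p.2.blocks_sum]
    omega
  · intro p hp
    simp
  · rintro ⟨i, c⟩ hp ⟨i', c'⟩ hp' h
    simp only [Composition.mk.injEq, List.cons.injEq, add_left_inj] at h
    obtain ⟨rfl, h⟩ := h
    rw [Composition.ext h]
  · intro c _
    rcases hc : c.blocks with _ | ⟨b, bs⟩
    · exact absurd (c.blocks_eq_nil.1 hc) hr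
    · have hb : 0 < b := c.blocks_pos (by rw [hc]; simp)
      have hsum := c.blocks_sum
      rw [hc, List.sum_cons] at hsum
      refine ⟨⟨b - 1, ⟨bs, fun {i} hi => c.blocks_pos (by rw [hc]; simp [hi]), by omega⟩⟩, ?_, ?_⟩
      · simp
        omega
      · ext1
        simp only [hc, List.cons.injEq, and_true]
        omega
  · intro p hp
    rfl

/-- Splitting off the first block of the composition reproduces the recursion `pathCoeff_eq`. -/
theorem sum_composition_chainSum (r L j : ℕ) (ks : List ℕ+) (hks : ks.length = r) :
    ∑ c : Composition r, chainSum c.blocks L j ks = pathCoeff L j ks := by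
  induction r using Nat.strong_induction_on generalizing L j ks with
  | _ r ih =>
    rcases Nat.eq_zero_or_pos r with rfl | hr
    · obtain rfl := List.eq_nil_of_length_eq_zero hks
      rw [pathCoeff_eq, Fintype.sum_eq_single (Composition.ones 0) fun c h => ?_]
      · simp [chainSum]
      · refine absurd (Composition.ext ?_) h
        rw [c.blocks_eq_nil.2 rfl]
        rfl
    · have hne : ks ≠ [] := by
        rintro rfl
        simp at hks
        omega
      rw [pathCoeff_eq, if_neg hne, zero_smul, zero_add, sum_composition_succ r hr.ne'
        fun bs => chainSum bs L j ks]
      simp only [chainSum]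
      rw [Finset.sum_congr rfl fun i _ => Finset.sum_comm, Finset.sum_comm]
      refine Finset.sum_congr rfl fun δ _ => ?_
      rw [blockSum, hks, Finset.smul_sum]
      refine Finset.sum_congr rfl fun i hi => ?_
      rw [Finset.mem_range] at hi
      rw [← Finset.smul_sum, ← Finset.smul_sum, ← Finset.mul_sum, Nat.add_sub_cancel, ← peel_sum]
      congr 3
      exact peel_congr i ks fun j ls hl => ih _ (by omega) δ j ls (by omega)

theorem X_pow_dvd_qFrac_pow (d : ℕ) {n : ℕ} (hn : 1 ≤ n) :
    (PowerSeries.X : ℚ⟦X⟧) ^ d ∣ qFrac d ^ n :=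
  (dvd_mul_right _ _).trans (dvd_pow_self _ (by omega))

/-- Indices `d i ≥ L` do not reach degree `N`, because `X ^ d i` divides the summand; an index `0`
may be admitted because `qFrac 0 = 0` occurs with a positive exponent. -/
theorem coeff_hSeries {m : ℕ} (ks : List ℕ+) (n : Fin m → ℕ) (hn : ∀ i, 1 ≤ n i)
    (hks : ∑ i, n i = ks.length) {N L : ℕ} (hN : N < L) :
    PowerSeries.coeff N (MvPowerSeries.coeff
        (Finsupp.equivFunOnFinite.symm fun j : Fin ks.length => (ks.get j : ℕ) - 1)
        (hSeries n fun l =>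
          xVar ks.length (tailSum n l) - xVar ks.length (tailSum n (l + 1)))) =
      PowerSeries.coeff N (∑ d ∈ strictSeqs m L,
        dpowProd (fun p => varCoeff n d (p + 1)) ks • ∏ i, qFrac (d i) ^ n i) := by
  have h1 : ∀ (e : Fin ks.length →₀ ℕ) (Y : Fin m → GenSeries ks.length),
      MvPowerSeries.coeff e (hSeries n Y) = PowerSeries.mk fun N =>
        ∑ᶠ d : {d : Fin m → ℕ // StrictMono d ∧ ∀ i, 0 < d i},
          PowerSeries.coeff N (MvPowerSeries.coeff e (hTerm n Y d)) := fun _ _ => rfl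
  rw [map_sum, h1, PowerSeries.coeff_mk, finsum_subtype_eq_finsum_cond
    (fun d : Fin m → ℕ => StrictMono d ∧ ∀ i, 0 < d i)
    (f := fun d : Fin m → ℕ => PowerSeries.coeff N (MvPowerSeries.coeff
      (Finsupp.equivFunOnFinite.symm fun j : Fin ks.length => (ks.get j : ℕ) - 1) (hTerm n
        (fun l => xVar ks.length (tailSum n l) - xVar ks.length (tailSum n (l + 1))) d)))]
  simp_rw [coeff_hTerm ks n _ hks]
  refine finsum_mem_eq_sum_of_inter_support_eq (s := {d | StrictMono d ∧ ∀ i, 0 < d i}) _ ?_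
  ext d
  simp only [Set.mem_inter_iff, Set.mem_ofPred_eq, Function.mem_support, Finset.mem_coe,
    mem_strictSeqs]
  refine and_congr_left fun h0 => ?_
  have hd : ∀ i, (PowerSeries.X : ℚ⟦X⟧) ^ d i ∣ ∏ i, qFrac (d i) ^ n i := fun i =>
    (X_pow_dvd_qFrac_pow (d i) (hn i)).trans (Finset.dvd_prod_of_mem _ (Finset.mem_univ i))
  constructor
  · rintro ⟨h1, h2⟩
    refine ⟨fun i => ?_, h1⟩
    by_contra hlt
    refine h0 ?_
    rw [PowerSeries.coeff_smul, PowerSeries.X_pow_dvd_iff.1 (hd i) N (by omega), smul_zero]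
  · rintro ⟨h1, h2⟩
    refine ⟨h2, fun i => ?_⟩
    by_contra hlt
    have hi : d i = 0 := by omega
    refine h0 ?_
    rw [Finset.prod_eq_zero (Finset.mem_univ i), smul_zero, map_zero]
    rw [hi, qFrac_zero, zero_pow (by have := hn i; omega)]

theorem sub_sizeUpTo {r : ℕ} (c : Composition r) {l : ℕ} (hl : l ≤ c.length) :
    r - c.sizeUpTo l = tailSum c.blocksFun l := by
  have h : c.sizeUpTo l + tailSum c.blocksFun l = r := by
    induction l with
    | zero => rw [tailSum_zero, c.sum_blocksFun, c.sizeUpTo_zero, zero_add]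
    | succ l ih =>
      have ih := ih (by omega)
      rw [c.sizeUpTo_succ (show l < c.length by omega), add_assoc]
      have : tailSum c.blocksFun l = c.blocks[l] + tailSum c.blocksFun (l + 1) := by
        rw [tailSum, tailSum, ← Finset.add_sum_erase _ _ (Finset.mem_univ (⟨l, hl⟩ : Fin c.length)),
          ← Finset.add_sum_erase _ (fun i : Fin c.length => if l + 1 ≤ (i : ℕ) then _ else 0)
            (Finset.mem_univ (⟨l, hl⟩ : Fin c.length))]
        simp only [le_refl, if_true, add_le_iff_nonpos_right, Nat.not_succ_le_self, if_false,
          zero_add]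
        congr 1
        refine Finset.sum_congr rfl fun i hi => ?_
        have : (i : ℕ) ≠ l := fun h => (Finset.mem_erase.1 hi).1 (Fin.ext h)
        exact if_congr (by omega) rfl rfl
      rw [← this, ih]
  omega

/-- Here `T_ш` meets the path character. Compositions are reversed because `chainSum` lists the
block of the largest index first. -/
theorem coeff_gsh (ks : List ℕ+) {N L : ℕ} (hN : N < L) :
    PowerSeries.coeff N (gsh ks) = PowerSeries.coeff N (pathCoeff L 0 ks) := by
  rw [gsh, tSh, map_sum, ← sum_composition_chainSum _ _ _ ks rfl,
    show ∑ c : Composition ks.length, chainSum c.blocks L 0 ks =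
      ∑ c : Composition ks.length, chainSum c.reverse.blocks L 0 ks from
      (Fintype.sum_bijective Composition.reverse Composition.reverse_bijective _ _
        fun _ => rfl).symm, map_sum, map_sum]
  refine Finset.sum_congr rfl fun c _ => ?_
  have hsmul : ∀ (e : Fin ks.length →₀ ℕ) (q : ℚ) (f : GenSeries ks.length),
      MvPowerSeries.coeff e (q • f) = q • MvPowerSeries.coeff e f := fun _ _ _ => rfl
  have hY : (fun l : Fin c.length => xVar ks.length (ks.length - c.sizeUpTo l) -
      xVar ks.length (ks.length - c.sizeUpTo (l + 1))) = fun l : Fin c.length =>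
      xVar ks.length (tailSum c.blocksFun l) - xVar ks.length (tailSum c.blocksFun (l + 1)) := by
    funext l
    rw [sub_sizeUpTo c l.2.le, sub_sizeUpTo c l.2]
  rw [hY, Composition.reverse_blocks, ← Composition.ofFn_blocksFun,
    ← sum_strictSeqs_eq_chainSum _ c.one_le_blocksFun L 0 ks c.sum_blocksFun,
    hsmul, PowerSeries.coeff_smul, PowerSeries.coeff_smul,
    coeff_hSeries ks _ c.one_le_blocksFun c.sum_blocksFun hN]
  simp

/-! ### The shuffle product formula -/

theorem modX_gsh (L : ℕ) (ks : List ℕ+) : modX L (gsh ks) = modX L (pathCoeff L 0 ks) :=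
  modX_eq_iff.2 fun _ hn => coeff_gsh ks hn

theorem modX_gshMap (L : ℕ) (x : H1) :
    modX L (gshMap x) = modX L (pathChar L (Finsupp.mapDomain toWord x)) := by
  induction x using Finsupp.induction_linear with
  | zero => simp
  | add x y hx hy => rw [map_add, map_add, Finsupp.mapDomain_add, map_add, map_add, hx, hy]
  | single ks c =>
    rw [← mul_one c, ← smul_eq_mul, ← Finsupp.smul_single, Finsupp.mapDomain_smul, map_smul gshMap,
      map_smul (pathChar L), PowerSeries.smul_eq_C_mul, PowerSeries.smul_eq_C_mul, map_mul, map_mul, gshMap,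
      Finsupp.linearCombination_single, one_smul, modX_gsh, Finsupp.mapDomain_single]
    rfl

theorem gshMap_shuffle1 (u v : List ℕ+) : gshMap (shuffle1 u v) = gsh u * gsh v := by
  refine eq_of_forall_modX fun L => ?_
  rw [modX_gshMap, mapDomain_shuffle1, isShuffleChar_pathChar L, map_mul, map_mul, modX_gsh,
    modX_gsh]
  rfl

/-! ### The conjugate sums -/

/-- The series `∑_{a > 0} a ^ (k - 1) / (k - 1)! q ^ (a b)`. -/
def letter (k : ℕ+) (b : ℕ) : ℚ⟦X⟧ :=
  bsum 0 fun a => PowerSeries.X ^ (a * b) * dpow ((k : ℕ) - 1) a • (1 : ℚ⟦X⟧)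

/-- The part of the series `gsh ks` in which all the conjugate summation indices exceed `M`. -/
def gshTail (M : ℕ) (ks : List ℕ+) : ℚ⟦X⟧ :=
  if ks = [] then 1 else bsum 0 fun δ => PowerSeries.X ^ (δ * M) * blockSum δ (pathCoeff δ) ks

@[simp]
theorem gshTail_nil (M : ℕ) : gshTail M [] = 1 := if_pos rfl

theorem blockSum_zero (g : ℕ → List ℕ+ → ℚ⟦X⟧) (ks : List ℕ+) : blockSum 0 g ks = 0 := by
  simp [blockSum, qFrac_zero]

theorem gsh_eq_gshTail (ks : List ℕ+) : gsh ks = gshTail 0 ks := by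
  rcases eq_or_ne ks [] with rfl | h
  · rw [gsh_nil, gshTail_nil]
  ext n
  rw [coeff_gsh ks (Nat.lt_succ_self n), pathCoeff_eq, if_neg h, zero_smul, zero_add, map_sum,
    gshTail, if_neg h, coeff_bsum]
  symm
  refine Finset.sum_subset_zero_on_sdiff (fun δ hδ => ?_) (fun δ hδ => ?_) fun δ _ => ?_
  · simp only [Finset.mem_Ioc, Finset.mem_range] at hδ ⊢
    omega
  · simp only [Finset.mem_sdiff, Finset.mem_Ioc, Finset.mem_range] at hδ
    have : δ = 0 := by omega
    rw [this, blockSum_zero, smul_zero, map_zero]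
  · simp [dpow]

/-- By `pathCoeff_eq` the coefficient is a convolution over `δ < d`; the sum over the gap `d - δ`
decouples and is `letter k M`. -/
theorem bsum_pathCoeff {M : ℕ} (hM : 1 ≤ M) (k : ℕ+) (ks : List ℕ+) :
    bsum 0 (fun d => PowerSeries.X ^ (d * M) * pathCoeff d ((k : ℕ) - 1) ks) =
      letter k M * gshTail M ks := by
  rcases eq_or_ne ks [] with rfl | h
  · rw [gshTail_nil, mul_one, letter]
    refine bsum_congr fun d _ => ?_
    rw [pathCoeff_eq]
    simp
  · rw [gshTail, if_neg h, letter, ← bsum_convolution hM _ _ (blockSum_zero _ _)]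
    refine bsum_congr fun d _ => ?_
    rw [pathCoeff_eq, if_neg h, zero_smul, zero_add]
    simp only [smul_mul_assoc, one_mul]

/-- The conjugation step, common to blocks of length one and two: expand in powers `q^(δb)`,
exchange the sums, and sum over `δ` by `bsum_pathCoeff`. -/
theorem bsum_X_pow_mul {M : ℕ} (F : ℕ → ℕ → ℚ⟦X⟧) (k : ℕ+) (ks : List ℕ+) (c : ℕ → ℚ⟦X⟧)
    (hF : ∀ δ, 0 < δ → F M δ = bsum M (fun b => c b * PowerSeries.X ^ (δ * b))) :
    bsum 0 (fun δ => F M δ * pathCoeff δ ((k : ℕ) - 1) ks) =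
      bsum M fun b => c b * (letter k b * gshTail b ks) := by
  have h1 : bsum 0 (fun δ => F M δ * pathCoeff δ ((k : ℕ) - 1) ks) =
      bsum 0 fun δ => bsum M fun b =>
        c b * (PowerSeries.X ^ (δ * b) * pathCoeff δ ((k : ℕ) - 1) ks) := by
    refine bsum_congr fun δ hδ => ?_
    rw [hF δ hδ, mul_comm, mul_bsum _ _ fun b => (X_pow_dvd_X_pow_mul' hδ b).mul_left _]
    refine bsum_congr fun b _ => ?_
    ring
  rw [h1, bsum_comm]
  refine bsum_congr fun b hb => ?_
  rw [← bsum_pathCoeff (by omega) k ks, mul_bsum _ _ fun d => X_pow_dvd_X_pow_mul (by omega) d _]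

theorem blockSum_cons {k : ℕ+} {ks : List ℕ+} (h : k ≠ 1 ∨ ks = []) (δ : ℕ)
    (g : ℕ → List ℕ+ → ℚ⟦X⟧) : blockSum δ g (k :: ks) = qFrac δ * g ((k : ℕ) - 1) ks := by
  rw [blockSum, List.length_cons, Finset.sum_range_succ', Finset.sum_eq_zero, zero_add]
  · simp [peel]
  · intro i hi
    rcases h with h | rfl
    · simp [peel, h]
    · simp at hi

theorem gshTail_cons {k : ℕ+} {ks : List ℕ+} (h : k ≠ 1 ∨ ks = []) (M : ℕ) :
    gshTail M (k :: ks) = bsum M fun b => letter k b * gshTail b ks := by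
  rw [gshTail, if_neg (List.cons_ne_nil _ _)]
  simp_rw [blockSum_cons h, ← mul_assoc]
  rw [bsum_X_pow_mul (fun M δ => PowerSeries.X ^ (δ * M) * qFrac δ) k ks (fun _ => 1)
    fun δ hδ => by simp only [one_mul]; exact X_pow_mul_qFrac hδ M]
  simp only [one_mul]

/-- The first block has length one or two, as `k ≠ 1` stops it. Length two has the factor `1 / 2!`
and `qFrac δ ^ 2`, expanded by `X_pow_mul_qFrac_sq`. -/
theorem gshTail_one_cons {k : ℕ+} (hk : k ≠ 1) (ks : List ℕ+) (M : ℕ) :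
    gshTail M (1 :: k :: ks) = bsum M (fun b => letter 1 b * gshTail b (k :: ks)) +
      (1 / 2 : ℚ) • bsum M fun b =>
        ((b : ℚ⟦X⟧) - (M : ℚ⟦X⟧) - 1) * (letter k b * gshTail b ks) := by
  have hb : ∀ (δ : ℕ) (g : ℕ → List ℕ+ → ℚ⟦X⟧), blockSum δ g (1 :: k :: ks) =
      qFrac δ * g (((1 : ℕ+) : ℕ) - 1) (k :: ks) +
        (1 / 2 : ℚ) • (qFrac δ ^ 2 * g ((k : ℕ) - 1) ks) := by
    intro δ g
    rw [blockSum, List.length_cons, List.length_cons, Finset.sum_range_succ',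
      Finset.sum_range_succ', Finset.sum_eq_zero, zero_add, add_comm]
    · simp [peel]
    · intro i _
      simp [peel, hk]
  rw [gshTail, if_neg (List.cons_ne_nil _ _)]
  simp_rw [hb, mul_add, mul_smul_comm, ← mul_assoc]
  rw [bsum_add, bsum_smul,
    bsum_X_pow_mul (fun M δ => PowerSeries.X ^ (δ * M) * qFrac δ) 1 (k :: ks) (fun _ => 1)
      fun δ hδ => by simp only [one_mul]; exact X_pow_mul_qFrac hδ M,
    bsum_X_pow_mul (fun M δ => PowerSeries.X ^ (δ * M) * qFrac δ ^ 2) k ks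
      (fun b => (b : ℚ⟦X⟧) - (M : ℚ⟦X⟧) - 1) fun δ hδ => X_pow_mul_qFrac_sq hδ M]
  simp only [one_mul, mul_assoc]

/-! ### Products of letters -/

/-- Faulhaber's formula for `k = 0`; then `(d - i)^(k+1) = d (d - i)^k - i (d - i)^k` reduces `(k +
1, l)` to `(k, l)` and `(k, l + 1)`. The top coefficient is a beta value. -/
theorem exists_polynomial_sum_pow_mul_pow (k l : ℕ) :
    ∃ p : Polynomial ℚ, p.coeff 0 = 0 ∧ p.natDegree ≤ k + l + 1 ∧
      p.coeff (k + l + 1) = (k.factorial * l.factorial : ℚ) / (k + l + 1).factorial ∧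
      ∀ d : ℕ, ∑ i ∈ Finset.range d, (i : ℚ) ^ l * ((d : ℚ) - i) ^ k = p.eval (d : ℚ) := by
  induction k generalizing l with
  | zero =>
    refine ⟨∑ i ∈ Finset.range (l + 1),
      Polynomial.C (bernoulli i * ((l + 1).choose i) / (l + 1)) * Polynomial.X ^ (l + 1 - i),
      ?_, ?_, ?_, fun d => ?_⟩
    · rw [Polynomial.finsetSum_coeff]
      refine Finset.sum_eq_zero fun i hi => ?_
      rw [Finset.mem_range] at hi
      rw [Polynomial.coeff_C_mul_X_pow, if_neg (by omega)]
    · refine Polynomial.natDegree_sum_le_of_forall_le _ _ fun i _ => ?_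
      exact (Polynomial.natDegree_C_mul_X_pow_le _ _).trans (by omega)
    · rw [Polynomial.finsetSum_coeff, Finset.sum_eq_single 0]
      · rw [Polynomial.coeff_C_mul_X_pow, if_pos (by omega), zero_add, Nat.factorial_succ]
        have := Nat.factorial_ne_zero l
        simp
        field_simp
      · intro i hi hi0
        rw [Finset.mem_range] at hi
        rw [Polynomial.coeff_C_mul_X_pow, if_neg (by omega)]
      · simp
    · simp only [pow_zero, mul_one]
      rw [sum_range_pow, Polynomial.eval_finsetSum]
      refine Finset.sum_congr rfl fun i _ => ?_
      simp
      ring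
  | succ k ih =>
    obtain ⟨p, hp0, hpd, hpc, hp⟩ := ih l
    obtain ⟨p', hp0', hpd', hpc', hp'⟩ := ih (l + 1)
    refine ⟨Polynomial.X * p - p', ?_, ?_, ?_, fun d => ?_⟩
    · simp [hp0']
    · refine (Polynomial.natDegree_sub_le _ _).trans (max_le ?_ (by omega))
      exact Polynomial.natDegree_mul_le.trans (by rw [Polynomial.natDegree_X]; omega)
    · rw [Polynomial.coeff_sub, show k + 1 + l + 1 = (k + l + 1) + 1 by ring,
        Polynomial.coeff_X_mul, hpc, show k + l + 1 + 1 = k + (l + 1) + 1 by ring, hpc',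
        show k + (l + 1) + 1 = (k + l + 1) + 1 by ring, Nat.factorial_succ (k + l + 1),
        Nat.factorial_succ k, Nat.factorial_succ l]
      have := Nat.factorial_ne_zero (k + l + 1)
      push_cast
      field_simp
      ring
    · rw [Polynomial.eval_sub, Polynomial.eval_mul, Polynomial.eval_X, ← hp, ← hp', Finset.mul_sum,
        ← Finset.sum_sub_distrib]
      refine Finset.sum_congr rfl fun i _ => ?_
      ring

/-- The polynomial has no constant term, so `j` starts at `2`. Thus no new letter `e₁` arises, which
keeps the lower terms accessible to `gsh_eq_nest`. -/
theorem exists_sum_dpow_mul_dpow (k l : ℕ+) :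
    ∃ c : ℕ+ → ℚ, ∀ d : ℕ,
      ∑ i ∈ Finset.range d, dpow ((k : ℕ) - 1) (d - i) * dpow ((l : ℕ) - 1) i =
        dpow (((k + l : ℕ+) : ℕ) - 1) d +
          ∑ j ∈ Finset.Ico 2 (k + l), c j * dpow ((j : ℕ) - 1) d := by
  obtain ⟨k, rfl⟩ : ∃ n : ℕ, k = n.succPNat := ⟨k.natPred, by simp⟩
  obtain ⟨l, rfl⟩ : ∃ n : ℕ, l = n.succPNat := ⟨l.natPred, by simp⟩
  obtain ⟨p, hp0, hpd, hpc, hp⟩ := exists_polynomial_sum_pow_mul_pow k l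
  have hk := Nat.factorial_ne_zero k
  have hl := Nat.factorial_ne_zero l
  -- The coefficient of `d^(j-1)`, renormalised from powers to divided powers.
  refine ⟨fun j => p.coeff ((j : ℕ) - 1) * ((j : ℕ) - 1).factorial / (k.factorial * l.factorial),
    fun d => ?_⟩
  have h1 : ∑ i ∈ Finset.range d, dpow ((k.succPNat : ℕ) - 1) (d - i) *
      dpow ((l.succPNat : ℕ) - 1) i = p.eval (d : ℚ) / (k.factorial * l.factorial) := by
    rw [← hp, Finset.sum_div]
    refine Finset.sum_congr rfl fun i hi => ?_
    rw [Finset.mem_range] at hi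
    simp only [dpow, Nat.succPNat_coe, Nat.succ_eq_add_one, Nat.add_sub_cancel, Nat.cast_sub hi.le]
    ring
  have h2 : ∑ j ∈ Finset.Ico 2 (k.succPNat + l.succPNat),
      p.coeff ((j : ℕ) - 1) * ((j : ℕ) - 1).factorial / (k.factorial * l.factorial) *
        dpow ((j : ℕ) - 1) d =
      ∑ m ∈ Finset.range (k + l), p.coeff (m + 1) * (d : ℚ) ^ (m + 1) /
        (k.factorial * l.factorial) := by
    symm
    refine Finset.sum_bij (fun m _ => (m + 1).succPNat) ?_ ?_ ?_ ?_
    · intro m hm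
      rw [Finset.mem_range] at hm
      rw [Finset.mem_Ico, ← PNat.coe_le_coe, ← PNat.coe_lt_coe]
      simp
      omega
    · intro m _ m' _ h
      simpa using h
    · intro j hj
      rw [Finset.mem_Ico, ← PNat.coe_le_coe, ← PNat.coe_lt_coe] at hj
      simp at hj
      refine ⟨(j : ℕ) - 2, by rw [Finset.mem_range]; omega, PNat.eq ?_⟩
      simp
      omega
    · intro m _
      have := Nat.factorial_ne_zero (m + 1)
      simp [dpow]
      field_simp
  rw [h1, h2, Polynomial.eval_eq_sum_range' (n := k + l + 2) (by omega), Finset.sum_range_succ',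
    hp0, Finset.sum_range_succ, hpc]
  have := Nat.factorial_ne_zero (k + l + 1)
  have h3 : ((k.succPNat + l.succPNat : ℕ+) : ℕ) - 1 = k + l + 1 := by
    simp
    omega
  rw [h3, dpow, zero_mul, add_zero, add_div, Finset.sum_div, add_comm]
  congr 1
  field_simp

/-- The product is a convolution over `d = a + a'`. The case `k = l = 1` is excluded because there
`letter 1` itself appears: the square is `letter 2 b - letter 1 b`. -/
theorem exists_letter_mul_letter (k l : ℕ+) (h : k ≠ 1 ∨ l ≠ 1) :
    ∃ c : ℕ+ → ℚ, ∀ b : ℕ, 1 ≤ b →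
      letter k b * letter l b =
        letter (k + l) b + ∑ j ∈ Finset.Ico 2 (k + l), c j • letter j b := by
  wlog hl : l ≠ 1 generalizing k l
  · obtain ⟨c, hc⟩ := this l k h.symm (h.resolve_right hl)
    refine ⟨c, fun b hb => ?_⟩
    rw [mul_comm, hc b hb, add_comm l k]
  obtain ⟨c, hc⟩ := exists_sum_dpow_mul_dpow k l
  refine ⟨c, fun b hb => ?_⟩
  have h0 : dpow ((l : ℕ) - 1) 0 • (1 : ℚ⟦X⟧) = 0 := by
    have h2 : (l : ℕ) ≠ 1 := fun h => hl (PNat.eq h)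
    have := l.pos
    rw [dpow_zero_right, if_neg (by omega), zero_smul]
  simp only [letter]
  rw [← bsum_convolution hb (fun a => dpow ((k : ℕ) - 1) a • (1 : ℚ⟦X⟧))
    (fun a => dpow ((l : ℕ) - 1) a • (1 : ℚ⟦X⟧)) h0]
  simp_rw [← bsum_smul]
  rw [← bsum_sum, ← bsum_add]
  refine bsum_congr fun d _ => ?_
  simp_rw [smul_mul_smul_comm, mul_one, ← Finset.sum_smul, hc d, mul_smul_comm, smul_smul,
    ← Finset.sum_smul, add_smul]

/-- On `q^(ab)` the operator acts as `a b`: the factor `a` raises the divided power, at the cost of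
`k`, and `b` remains as the index weight. -/
theorem qD_letter (k : ℕ+) (b : ℕ) :
    qD (letter k b) = ((k : ℕ) : ℚ) • ((b : ℚ⟦X⟧) * letter (k + 1) b) := by
  ext n
  have hb : (b : ℚ⟦X⟧) = PowerSeries.C (b : ℚ) := by simp
  rw [coeff_qD, hb, letter, letter, coeff_bsum, PowerSeries.coeff_smul, PowerSeries.coeff_C_mul,
    coeff_bsum, smul_eq_mul, Finset.mul_sum, Finset.mul_sum, Finset.mul_sum]
  refine Finset.sum_congr rfl fun a _ => ?_
  simp only [mul_smul_comm, mul_one, PowerSeries.coeff_smul, PowerSeries.coeff_X_pow, smul_eq_mul]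
  split_ifs with h
  · obtain ⟨m, hm⟩ : ∃ m, (k : ℕ) = m + 1 := ⟨(k : ℕ) - 1, by have := k.pos; omega⟩
    have := Nat.factorial_ne_zero m
    rw [h, PNat.add_coe, hm]
    simp [dpow, Nat.factorial_succ]
    field_simp
    ring
  · simp

theorem X_pow_dvd_letter (k : ℕ+) (b : ℕ) : (PowerSeries.X : ℚ⟦X⟧) ^ b ∣ letter k b := by
  rw [PowerSeries.X_pow_dvd_iff]
  intro n hn
  rw [letter, coeff_bsum]
  refine Finset.sum_eq_zero fun a ha => ?_
  rw [Finset.mem_Ioc] at ha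
  rw [mul_smul_comm, mul_one, PowerSeries.coeff_smul, PowerSeries.coeff_X_pow, if_neg, smul_zero]
  have := Nat.le_mul_of_pos_left b ha.1
  omega

/-! ### Nested sums -/

/-- The nested sum `∑_{M < b₁ < ⋯ < b_r} f₁(b₁) ⋯ f_r(b_r)`. -/
def nest : List (ℕ → ℚ⟦X⟧) → ℕ → ℚ⟦X⟧
  | [], _ => 1
  | f :: fs, M => bsum M fun b => f b * nest fs b

/-- The summands of the quasi-shuffle product of two lists of functions. -/
def quasiShuffle : List (ℕ → ℚ⟦X⟧) → List (ℕ → ℚ⟦X⟧) → List (List (ℕ → ℚ⟦X⟧))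
  | [], w => [w]
  | f :: v, [] => [f :: v]
  | f :: v, g :: w =>
      (quasiShuffle v (g :: w)).map (f :: ·) ++ (quasiShuffle (f :: v) w).map (g :: ·) ++
        (quasiShuffle v w).map ((fun b => f b * g b) :: ·)
termination_by v w => v.length + w.length

theorem bsum_mul_sum_nest (M : ℕ) (f : ℕ → ℚ⟦X⟧) (l : List (List (ℕ → ℚ⟦X⟧))) :
    bsum M (fun b => f b * (l.map (nest · b)).sum) = ((l.map (f :: ·)).map (nest · M)).sum := by
  induction l with
  | nil => ext n; simp [coeff_bsum]
  | cons u l ih => simp only [List.map_cons, List.sum_cons, mul_add, bsum_add, ih]; rfl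

/-- Compare the smallest summation indices of the two nested sums. -/
theorem nest_mul (u v : List (ℕ → ℚ⟦X⟧)) (hu : ∀ f ∈ u, ∀ b, PowerSeries.X ^ b ∣ f b)
    (hv : ∀ f ∈ v, ∀ b, PowerSeries.X ^ b ∣ f b) (M : ℕ) :
    nest u M * nest v M = ((quasiShuffle u v).map (nest · M)).sum := by
  induction hn : u.length + v.length using Nat.strong_induction_on generalizing u v M with
  | _ n ih =>
    rcases u with _ | ⟨f, u⟩
    · simp [quasiShuffle, nest]
    rcases v with _ | ⟨g, v⟩
    · simp [quasiShuffle, nest]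
    have hu' := fun f hf => hu f (List.mem_cons_of_mem _ hf)
    have hv' := fun f hf => hv f (List.mem_cons_of_mem _ hf)
    have hf := hu f List.mem_cons_self
    have hg := hv g List.mem_cons_self
    simp only [List.length_cons] at hn
    have h1 := fun b => ih _ (by simp; omega) u (g :: v) hu' hv b rfl
    have h2 := fun b => ih _ (by simp; omega) (f :: u) v hu hv' b rfl
    have h3 := fun b => ih _ (by omega) u v hu' hv' b rfl
    rw [quasiShuffle, List.map_append, List.map_append, List.sum_append, List.sum_append,
      ← bsum_mul_sum_nest, ← bsum_mul_sum_nest, ← bsum_mul_sum_nest]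
    simp_rw [← h1, ← h2, ← h3]
    rw [nest, nest, bsum_mul M (fun b => (hf b).mul_right _) fun b => (hg b).mul_right _]
    congr 1
    · congr 1
      · refine bsum_congr fun b _ => ?_
        rw [mul_assoc]
        rfl
      · refine bsum_congr fun b _ => ?_
        rw [mul_assoc, mul_comm (nest (f :: u) b)]
        rfl
    · refine bsum_congr fun b _ => ?_
      ring

theorem nest_add (pre post : List (ℕ → ℚ⟦X⟧)) (f g : ℕ → ℚ⟦X⟧) (M : ℕ) :
    nest (pre ++ (fun b => f b + g b) :: post) M =
      nest (pre ++ f :: post) M + nest (pre ++ g :: post) M := by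
  induction pre generalizing M with
  | nil => simp only [List.nil_append, nest, add_mul, bsum_add]
  | cons h pre ih => simp only [List.cons_append, nest, ih, mul_add, bsum_add]

theorem nest_smul (pre post : List (ℕ → ℚ⟦X⟧)) (c : ℚ) (f : ℕ → ℚ⟦X⟧) (M : ℕ) :
    nest (pre ++ (fun b => c • f b) :: post) M = c • nest (pre ++ f :: post) M := by
  induction pre generalizing M with
  | nil => simp only [List.nil_append, nest, smul_mul_assoc, bsum_smul]
  | cons h pre ih => simp only [List.cons_append, nest, ih, mul_smul_comm, bsum_smul]

theorem nest_sum {ι : Type*} (s : Finset ι) (pre post : List (ℕ → ℚ⟦X⟧)) (f : ι → ℕ → ℚ⟦X⟧)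
    (M : ℕ) :
    nest (pre ++ (fun b => ∑ i ∈ s, f i b) :: post) M =
      ∑ i ∈ s, nest (pre ++ f i :: post) M := by
  induction pre generalizing M with
  | nil => simp only [List.nil_append, nest, Finset.sum_mul, bsum_sum]
  | cons h pre ih => simp only [List.cons_append, nest, ih, Finset.mul_sum, bsum_sum]

theorem nest_congr (pre post : List (ℕ → ℚ⟦X⟧)) {f g : ℕ → ℚ⟦X⟧} (h : ∀ b, 1 ≤ b → f b = g b)
    (M : ℕ) : nest (pre ++ f :: post) M = nest (pre ++ g :: post) M := by
  induction pre generalizing M with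
  | nil => exact bsum_congr fun b hb => by rw [h b (by omega)]
  | cons h pre ih => simp only [List.cons_append, nest, ih]

/-- The product of two letters in a nested sum may be replaced by their sum, modulo the nested sums
in which it is replaced by a smaller letter. -/
theorem nest_letter_mul_letter_sub_mem (W : Submodule ℚ ℚ⟦X⟧) (pre post : List (ℕ → ℚ⟦X⟧))
    {k l : ℕ+} (hkl : k ≠ 1 ∨ l ≠ 1)
    (h : ∀ j : ℕ+, 2 ≤ (j : ℕ) → (j : ℕ) < k + l → nest (pre ++ letter j :: post) 0 ∈ W) :
    nest (pre ++ (fun b => letter k b * letter l b) :: post) 0 -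
      nest (pre ++ letter (k + l) :: post) 0 ∈ W := by
  obtain ⟨c, hc⟩ := exists_letter_mul_letter k l hkl
  rw [nest_congr pre post hc, nest_add, nest_sum, add_sub_cancel_left]
  refine W.sum_mem fun j hj => ?_
  rw [nest_smul]
  refine W.smul_mem _ (h j ?_ ?_)
  · exact_mod_cast (Finset.mem_Ico.1 hj).1
  · exact_mod_cast (Finset.mem_Ico.1 hj).2

theorem qD_nest_cons (f : ℕ → ℚ⟦X⟧) (fs : List (ℕ → ℚ⟦X⟧)) (M : ℕ) :
    qD (nest (f :: fs) M) =
      nest ((fun b => qD (f b)) :: fs) M + bsum M fun b => f b * qD (nest fs b) := by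
  rw [nest, qD_bsum, nest, ← bsum_add]
  simp only [qD_mul]

/-- All the letters but the last one differ from `e₁`. -/
def NoInnerOne : List ℕ+ → Prop
  | [] => True
  | k :: ks => (k ≠ 1 ∨ ks = []) ∧ NoInnerOne ks

theorem gshTail_eq_nest {ks : List ℕ+} (h : NoInnerOne ks) (M : ℕ) :
    gshTail M ks = nest (ks.map letter) M := by
  induction ks generalizing M with
  | nil => simp [nest]
  | cons k ks ih =>
    rw [gshTail_cons h.1, List.map_cons, nest]
    simp_rw [ih h.2]

theorem gsh_eq_nest {ks : List ℕ+} (h : NoInnerOne ks) : gsh ks = nest (ks.map letter) 0 := by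
  rw [gsh_eq_gshTail, gshTail_eq_nest h]

/-- The letter `e_k`, multiplied with the summation index. -/
def indexLetter (k : ℕ+) (b : ℕ) : ℚ⟦X⟧ := (b : ℚ⟦X⟧) * letter k b

theorem gshTail_one_cons_eq_nest {k : ℕ+} {ks : List ℕ+} (hk : k ≠ 1) (h : NoInnerOne ks) (M : ℕ) :
    gshTail M (1 :: k :: ks) = nest (letter 1 :: letter k :: ks.map letter) M +
      (1 / 2 : ℚ) • (nest (indexLetter k :: ks.map letter) M -
        (M : ℚ⟦X⟧) * nest (letter k :: ks.map letter) M - nest (letter k :: ks.map letter) M) := by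
  have hk' : NoInnerOne (k :: ks) := ⟨Or.inl hk, h⟩
  have hg : ∀ b, (PowerSeries.X : ℚ⟦X⟧) ^ b ∣ letter k b * nest (ks.map letter) b :=
    fun b => (X_pow_dvd_letter k b).mul_right _
  rw [gshTail_one_cons hk]
  simp_rw [gshTail_eq_nest hk', gshTail_eq_nest h]
  congr 2
  rw [nest, nest, mul_bsum _ _ hg, ← bsum_sub, ← bsum_sub]
  refine bsum_congr fun b _ => ?_
  rw [indexLetter]
  ring

theorem gsh_one_cons {k : ℕ+} {ks : List ℕ+} (hk : k ≠ 1) (h : NoInnerOne ks) :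
    gsh (1 :: k :: ks) = nest (letter 1 :: letter k :: ks.map letter) 0 +
      (1 / 2 : ℚ) • (nest (indexLetter k :: ks.map letter) 0 -
        nest (letter k :: ks.map letter) 0) := by
  rw [gsh_eq_gshTail, gshTail_one_cons_eq_nest hk h]
  simp

/-- The lower bound in the correction for `e₁` is now the index of `l`, so it becomes an index
weight on `l`. -/
theorem gshTail_cons_one_cons {l k : ℕ+} {ks : List ℕ+} (hl : l ≠ 1) (hk : k ≠ 1)
    (h : NoInnerOne ks) (M : ℕ) :
    gshTail M (l :: 1 :: k :: ks) =
      nest (letter l :: letter 1 :: letter k :: ks.map letter) M +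
      (1 / 2 : ℚ) • (nest (letter l :: indexLetter k :: ks.map letter) M -
        nest (indexLetter l :: letter k :: ks.map letter) M -
        nest (letter l :: letter k :: ks.map letter) M) := by
  rw [gshTail_cons (Or.inl hl)]
  simp_rw [gshTail_one_cons_eq_nest hk h]
  rw [nest, nest, nest, nest, ← bsum_sub, ← bsum_sub, ← bsum_smul, ← bsum_add]
  refine bsum_congr fun b _ => ?_
  rw [indexLetter, mul_add, mul_smul_comm]
  congr 2
  ring

theorem gsh_cons_one_cons {l k : ℕ+} {ks : List ℕ+} (hl : l ≠ 1) (hk : k ≠ 1)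
    (h : NoInnerOne ks) :
    gsh (l :: 1 :: k :: ks) = nest (letter l :: letter 1 :: letter k :: ks.map letter) 0 +
      (1 / 2 : ℚ) • (nest (letter l :: indexLetter k :: ks.map letter) 0 -
        nest (indexLetter l :: letter k :: ks.map letter) 0 -
        nest (letter l :: letter k :: ks.map letter) 0) := by
  rw [gsh_eq_gshTail, gshTail_cons_one_cons hl hk h]

theorem gsh_cons_cons_one_cons {m l k : ℕ+} {ks : List ℕ+} (hm : m ≠ 1) (hl : l ≠ 1)
    (hk : k ≠ 1) (h : NoInnerOne ks) :
    gsh (m :: l :: 1 :: k :: ks) =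
      nest (letter m :: letter l :: letter 1 :: letter k :: ks.map letter) 0 +
      (1 / 2 : ℚ) • (nest (letter m :: letter l :: indexLetter k :: ks.map letter) 0 -
        nest (letter m :: indexLetter l :: letter k :: ks.map letter) 0 -
        nest (letter m :: letter l :: letter k :: ks.map letter) 0) := by
  rw [gsh_eq_gshTail, gshTail_cons (Or.inl hm)]
  simp_rw [gshTail_cons_one_cons hl hk h]
  rw [nest, nest, nest, nest, ← bsum_sub, ← bsum_sub, ← bsum_smul, ← bsum_add]
  refine bsum_congr fun b _ => ?_
  rw [mul_add, mul_smul_comm, mul_sub, mul_sub]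

/-! ### The weight filtration -/

/-- The weight `k₁ + ⋯ + k_r` of a monomial. -/
abbrev weight (ks : List ℕ+) : ℕ := (ks.map fun i : ℕ+ => (i : ℕ)).sum

theorem gsh_mem_gshLE {ks : List ℕ+} {n : ℕ} (h : weight ks ≤ n) : gsh ks ∈ gshLE n :=
  Submodule.subset_span ⟨ks, h, rfl⟩

theorem nest_mem_gshLE {ks : List ℕ+} {n : ℕ} (h : NoInnerOne ks) (hw : weight ks ≤ n) :
    nest (ks.map letter) 0 ∈ gshLE n :=
  gsh_eq_nest h ▸ gsh_mem_gshLE hw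

theorem length_toWord (ks : List ℕ+) : (toWord ks).length = weight ks := by
  induction ks with
  | nil => rfl
  | cons k ks ih =>
    have := k.pos
    simp only [toWord, List.length_cons, List.length_append, List.length_replicate, ih, weight,
      List.map_cons, List.sum_cons]
    omega

/-- Weight is word length in `e₀`, `e₁`, and shuffling does not exceed the total length. -/
theorem gsh_mul_gsh_mem_gshLE (u v : List ℕ+) : gsh u * gsh v ∈ gshLE (weight u + weight v) := by
  rw [← gshMap_shuffle1, gshMap, Finsupp.linearCombination_apply]
  refine Submodule.sum_mem _ fun ks hks => Submodule.smul_mem _ _ (gsh_mem_gshLE ?_)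
  by_contra hlt
  rw [Finsupp.mem_support_iff] at hks
  refine hks ?_
  rw [shuffle1, Finsupp.comapDomain_apply]
  refine eq_zero_on_shuffle (toWord u) (toWord v) (Finsupp.lapply (toWord ks)) fun w hw => ?_
  rw [Finsupp.lapply_apply, Finsupp.single_apply, if_neg]
  rintro rfl
  rw [length_toWord, length_toWord, length_toWord] at hw
  exact hlt hw

theorem gshLE_le_span_range (n : ℕ) : gshLE n ≤ Submodule.span ℚ (Set.range gsh) :=
  Submodule.span_mono (by rintro _ ⟨ks, _, rfl⟩; exact ⟨ks, rfl⟩)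

theorem gshMap_mem_span_range (x : H1) : gshMap x ∈ Submodule.span ℚ (Set.range gsh) := by
  rw [← Finsupp.range_linearCombination]
  exact ⟨x, rfl⟩

theorem gshMap_ds (u v : List ℕ+) : gshMap (ds u v) = gshMap (stuffle u v) - gsh u * gsh v := by
  rw [ds, map_sub, gshMap_shuffle1]

theorem gshMap_single (ks : List ℕ+) : gshMap (Finsupp.single ks 1) = gsh ks := by
  simp [gshMap]

/-! ### The failure of the harmonic product formula -/

theorem nest_letters_mul (u v : List ℕ+) :
    nest (u.map letter) 0 * nest (v.map letter) 0 =
      ((quasiShuffle (u.map letter) (v.map letter)).map (nest · 0)).sum := by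
  refine nest_mul _ _ ?_ ?_ 0 <;>
  · intro f hf b
    obtain ⟨k, _, rfl⟩ := List.mem_map.1 hf
    exact X_pow_dvd_letter k b

theorem ne_one_of_two_le {k : ℕ+} (h : 2 ≤ (k : ℕ)) : k ≠ 1 := by
  rintro rfl
  simp at h

/-- The harmonic product inserts `e₁` at every position. The corrections `(b_i - b_{i-1} - 1) / 2`
telescope to half the last index, and a final `e₁` needs none. The `-1` terms and the collision
terms lie in lower weight. -/
theorem gshMap_ds_one_two_sub_mem {k l : ℕ+} (hk : k ≠ 1) (hl : l ≠ 1) {n : ℕ}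
    (hn : (k : ℕ) + l ≤ n) :
    gshMap (ds [1] [k, l]) - (1 / 2 : ℚ) • nest [letter k, indexLetter l] 0 ∈ gshLE n := by
  have h0 : nest [letter k, letter l] 0 ∈ gshLE n :=
    nest_mem_gshLE (ks := [k, l]) (by simp [NoInnerOne, hk]) (by simp [weight]; omega)
  have h1 := nest_letter_mul_letter_sub_mem (gshLE n) [] [letter l] (k := 1) (l := k) (Or.inr hk)
    fun j hj hj' => nest_mem_gshLE (ks := [j, l])
      (by simp [NoInnerOne, ne_one_of_two_le hj]) (by simp [weight] at *; omega)
  have h2 := nest_letter_mul_letter_sub_mem (gshLE n) [letter k] [] (k := 1) (l := l) (Or.inr hl)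
    fun j hj hj' => nest_mem_gshLE (ks := [k, j])
      (by simp [NoInnerOne, hk]) (by simp [weight] at *; omega)
  have hk' : 1 + k ≠ 1 := ne_one_of_two_le (by have := k.pos; simp; omega)
  have hp := nest_letters_mul [1] [k, l]
  rw [gshMap_ds, gsh_eq_nest (ks := [1]) (by simp [NoInnerOne]),
    gsh_eq_nest (ks := [k, l]) (by simp [NoInnerOne, hk]), hp]
  simp only [stuffle, quasiShuffle, map_add, prepend_single, gshMap_single, List.map_cons,
    List.map_nil, List.sum_cons, List.sum_nil, List.cons_append, List.nil_append]
  rw [gsh_one_cons hk (by simp [NoInnerOne]), gsh_cons_one_cons hk hl (by simp [NoInnerOne]),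
    gsh_eq_nest (ks := [k, l, 1]) (by simp [NoInnerOne, hk, hl]),
    gsh_eq_nest (ks := [k, 1 + l]) (by simp [NoInnerOne, hk]),
    gsh_eq_nest (ks := [1 + k, l]) (by simp [NoInnerOne, hk'])]
  convert sub_mem (neg_mem (add_mem h1 h2)) h0 using 1
  simp only [List.map_cons, List.map_nil, List.nil_append, List.cons_append]
  module

theorem gshMap_ds_one_three_sub_mem {k l m : ℕ+} (hk : k ≠ 1) (hl : l ≠ 1) (hm : m ≠ 1) {n : ℕ}
    (hn : (k : ℕ) + l + m ≤ n) :
    gshMap (ds [1] [k, l, m]) - (1 / 2 : ℚ) • nest [letter k, letter l, indexLetter m] 0 ∈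
      gshLE n := by
  have h0 : nest [letter k, letter l, letter m] 0 ∈ gshLE n :=
    nest_mem_gshLE (ks := [k, l, m]) (by simp [NoInnerOne, hk, hl])
      (by simp [weight] at *; omega)
  have h1 := nest_letter_mul_letter_sub_mem (gshLE n) [] [letter l, letter m] (k := 1) (l := k)
    (Or.inr hk) fun j hj hj' => nest_mem_gshLE (ks := [j, l, m])
      (by simp [NoInnerOne, hl, ne_one_of_two_le hj]) (by simp [weight] at *; omega)
  have h2 := nest_letter_mul_letter_sub_mem (gshLE n) [letter k] [letter m] (k := 1) (l := l)
    (Or.inr hl) fun j hj hj' => nest_mem_gshLE (ks := [k, j, m])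
      (by simp [NoInnerOne, hk, ne_one_of_two_le hj]) (by simp [weight] at *; omega)
  have h3 := nest_letter_mul_letter_sub_mem (gshLE n) [letter k, letter l] [] (k := 1) (l := m)
    (Or.inr hm) fun j hj hj' => nest_mem_gshLE (ks := [k, l, j])
      (by simp [NoInnerOne, hk, hl]) (by simp [weight] at *; omega)
  have hk' : 1 + k ≠ 1 :=
    ne_one_of_two_le (by have := PNat.pos 1; have := PNat.pos k; simp; omega)
  have hl' : 1 + l ≠ 1 :=
    ne_one_of_two_le (by have := PNat.pos 1; have := PNat.pos l; simp; omega)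
  have hp := nest_letters_mul [1] [k, l, m]
  rw [gshMap_ds, gsh_eq_nest (ks := [1]) (by simp [NoInnerOne]),
    gsh_eq_nest (ks := [k, l, m]) (by simp [NoInnerOne, hk, hl]), hp]
  simp only [stuffle, quasiShuffle, map_add, prepend_single, gshMap_single, List.map_cons,
    List.map_nil, List.sum_cons, List.sum_nil, List.cons_append, List.nil_append]
  rw [gsh_one_cons hk (by simp [NoInnerOne, hl]), gsh_cons_one_cons hk hl (by simp [NoInnerOne]),
    gsh_cons_cons_one_cons hk hl hm (by simp [NoInnerOne]),
    gsh_eq_nest (ks := [k, l, m, 1]) (by simp [NoInnerOne, hk, hl, hm]),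
    gsh_eq_nest (ks := [k, l, 1 + m]) (by simp [NoInnerOne, hk, hl]),
    gsh_eq_nest (ks := [k, 1 + l, m]) (by simp [NoInnerOne, hk, hl']),
    gsh_eq_nest (ks := [1 + k, l, m]) (by simp [NoInnerOne, hk', hl])]
  -- Three non-final positions of `e₁` each contribute `-1/2` times the sum in `h0`.
  convert sub_mem (neg_mem (add_mem (add_mem h1 h2) h3)) ((gshLE n).smul_mem (3 / 2) h0) using 1
  simp only [List.map_cons, List.map_nil, List.nil_append, List.cons_append]
  module

/-- Only the word `[l, 1, k]` of the harmonic product has an inner `e₁`, so just one correction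
occurs. -/
theorem gshMap_ds_two_one_sub_mem {k l : ℕ+} (hk : k ≠ 1) (hl : l ≠ 1) {n : ℕ}
    (hn : (k : ℕ) + l ≤ n) :
    gshMap (ds [k] [l, 1]) - (1 / 2 : ℚ) •
      (nest [letter l, indexLetter k] 0 - nest [indexLetter l, letter k] 0) ∈ gshLE n := by
  have h0 : nest [letter l, letter k] 0 ∈ gshLE n :=
    nest_mem_gshLE (ks := [l, k]) (by simp [NoInnerOne, hl])
      (by simp [weight] at *; omega)
  have h1 := nest_letter_mul_letter_sub_mem (gshLE n) [] [letter 1] (k := k) (l := l)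
    (Or.inl hk) fun j hj hj' => nest_mem_gshLE (ks := [j, 1])
      (by simp [NoInnerOne, ne_one_of_two_le hj]) (by simp [weight] at *; omega)
  have h2 := nest_letter_mul_letter_sub_mem (gshLE n) [letter l] [] (k := k) (l := 1)
    (Or.inl hk) fun j hj hj' => nest_mem_gshLE (ks := [l, j])
      (by simp [NoInnerOne, hl]) (by rw [PNat.one_coe] at hj'; simp [weight]; omega)
  have hkl : k + l ≠ 1 :=
    ne_one_of_two_le (by have := PNat.pos k; have := PNat.pos l; simp; omega)
  have hp := nest_letters_mul [k] [l, 1]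
  rw [gshMap_ds, gsh_eq_nest (ks := [k]) (by simp [NoInnerOne]),
    gsh_eq_nest (ks := [l, 1]) (by simp [NoInnerOne, hl]), hp]
  simp only [stuffle, quasiShuffle, map_add, prepend_single, gshMap_single, List.map_cons,
    List.map_nil, List.sum_cons, List.sum_nil, List.cons_append, List.nil_append]
  rw [gsh_cons_one_cons hl hk (by simp [NoInnerOne]),
    gsh_eq_nest (ks := [k, l, 1]) (by simp [NoInnerOne, hk, hl]),
    gsh_eq_nest (ks := [l, k, 1]) (by simp [NoInnerOne, hk, hl]),
    gsh_eq_nest (ks := [l, k + 1]) (by simp [NoInnerOne, hl]),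
    gsh_eq_nest (ks := [k + l, 1]) (by simp [NoInnerOne, hkl])]
  convert sub_mem (neg_mem (add_mem h1 h2)) ((gshLE n).smul_mem (1 / 2) h0) using 1
  simp only [List.map_cons, List.map_nil, List.nil_append, List.cons_append]
  module

theorem gshMap_ds_three_one_sub_mem {k l m : ℕ+} (hk : k ≠ 1) (hl : l ≠ 1) (hm : m ≠ 1) {n : ℕ}
    (hn : (k : ℕ) + l + m ≤ n) :
    gshMap (ds [k] [l, m, 1]) - (1 / 2 : ℚ) •
      (nest [letter l, letter m, indexLetter k] 0 - nest [letter l, indexLetter m, letter k] 0) ∈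
      gshLE n := by
  have h0 : nest [letter l, letter m, letter k] 0 ∈ gshLE n :=
    nest_mem_gshLE (ks := [l, m, k]) (by simp [NoInnerOne, hl, hm])
      (by simp [weight] at *; omega)
  have h1 := nest_letter_mul_letter_sub_mem (gshLE n) [] [letter m, letter 1] (k := k) (l := l)
    (Or.inl hk) fun j hj hj' => nest_mem_gshLE (ks := [j, m, 1])
      (by simp [NoInnerOne, hm, ne_one_of_two_le hj]) (by simp [weight] at *; omega)
  have h2 := nest_letter_mul_letter_sub_mem (gshLE n) [letter l] [letter 1] (k := k) (l := m)
    (Or.inl hk) fun j hj hj' => nest_mem_gshLE (ks := [l, j, 1])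
      (by simp [NoInnerOne, hl, ne_one_of_two_le hj]) (by simp [weight] at *; omega)
  have h3 := nest_letter_mul_letter_sub_mem (gshLE n) [letter l, letter m] [] (k := k) (l := 1)
    (Or.inl hk) fun j hj hj' => nest_mem_gshLE (ks := [l, m, j])
      (by simp [NoInnerOne, hl, hm]) (by rw [PNat.one_coe] at hj'; simp [weight]; omega)
  have hkl : k + l ≠ 1 :=
    ne_one_of_two_le (by have := PNat.pos k; have := PNat.pos l; simp; omega)
  have hkm : k + m ≠ 1 :=
    ne_one_of_two_le (by have := PNat.pos k; have := PNat.pos m; simp; omega)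
  have hp := nest_letters_mul [k] [l, m, 1]
  rw [gshMap_ds, gsh_eq_nest (ks := [k]) (by simp [NoInnerOne]),
    gsh_eq_nest (ks := [l, m, 1]) (by simp [NoInnerOne, hl, hm]), hp]
  simp only [stuffle, quasiShuffle, map_add, prepend_single, gshMap_single, List.map_cons,
    List.map_nil, List.sum_cons, List.sum_nil, List.cons_append, List.nil_append]
  rw [gsh_cons_cons_one_cons hl hm hk (by simp [NoInnerOne]),
    gsh_eq_nest (ks := [k, l, m, 1]) (by simp [NoInnerOne, hk, hl, hm]),
    gsh_eq_nest (ks := [l, k, m, 1]) (by simp [NoInnerOne, hk, hl, hm]),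
    gsh_eq_nest (ks := [l, m, k, 1]) (by simp [NoInnerOne, hk, hl, hm]),
    gsh_eq_nest (ks := [l, m, k + 1]) (by simp [NoInnerOne, hl, hm]),
    gsh_eq_nest (ks := [l, k + m, 1]) (by simp [NoInnerOne, hl, hkm]),
    gsh_eq_nest (ks := [k + l, m, 1]) (by simp [NoInnerOne, hkl, hm])]
  convert sub_mem (neg_mem (add_mem (add_mem h1 h2) h3)) ((gshLE n).smul_mem (1 / 2) h0) using 1
  simp only [List.map_cons, List.map_nil, List.nil_append, List.cons_append]
  module

/-- With an inner `e₁` this nested sum need not be the corresponding `gsh`. It is isolated from `gsh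
[k, 1] * gsh [l]`, which has bounded weight by the shuffle formula; the other quasi-shuffle terms
reduce to nested sums without inner `e₁`. -/
theorem nest_letter_one_letter_mem {k l : ℕ+} (hk : k ≠ 1) (hl : l ≠ 1) {n : ℕ}
    (hn : (k : ℕ) + 1 + l ≤ n) : nest [letter k, letter 1, letter l] 0 ∈ gshLE n := by
  have h1 : nest [letter k, letter l, letter 1] 0 ∈ gshLE n :=
    nest_mem_gshLE (ks := [k, l, 1]) (by simp [NoInnerOne, hk, hl])
      (by simp [weight] at *; omega)
  have h2 : nest [letter l, letter k, letter 1] 0 ∈ gshLE n :=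
    nest_mem_gshLE (ks := [l, k, 1]) (by simp [NoInnerOne, hk, hl])
      (by simp [weight] at *; omega)
  have h3 : nest [letter k, letter (1 + l)] 0 ∈ gshLE n :=
    nest_mem_gshLE (ks := [k, 1 + l]) (by simp [NoInnerOne, hk])
      (by simp [weight] at *; omega)
  have hkl : k + l ≠ 1 :=
    ne_one_of_two_le (by have := PNat.pos k; have := PNat.pos l; simp; omega)
  have h4 : nest [letter (k + l), letter 1] 0 ∈ gshLE n :=
    nest_mem_gshLE (ks := [k + l, 1]) (by simp [NoInnerOne, hkl])
      (by simp [weight] at *; omega)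
  have h5 := nest_letter_mul_letter_sub_mem (gshLE n) [letter k] [] (k := 1) (l := l)
    (Or.inr hl) fun j hj hj' => nest_mem_gshLE (ks := [k, j])
      (by simp [NoInnerOne, hk]) (by simp [weight] at *; omega)
  have h6 := nest_letter_mul_letter_sub_mem (gshLE n) [] [letter 1] (k := k) (l := l)
    (Or.inl hk) fun j hj hj' => nest_mem_gshLE (ks := [j, 1])
      (by simp [NoInnerOne, ne_one_of_two_le hj]) (by simp [weight] at *; omega)
  have h7 : gsh [k, 1] * gsh [l] ∈ gshLE n := by
    have h := gsh_mul_gsh_mem_gshLE [k, 1] [l]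
    refine Submodule.span_mono ?_ h
    rintro _ ⟨ks, hks, rfl⟩
    refine ⟨ks, hks.trans ?_, rfl⟩
    simp [weight]
    omega
  rw [gsh_eq_nest (ks := [k, 1]) (by simp [NoInnerOne, hk]),
    gsh_eq_nest (ks := [l]) (by simp [NoInnerOne]), nest_letters_mul] at h7
  simp only [quasiShuffle, List.map_cons, List.map_nil, List.sum_cons, List.sum_nil,
    List.cons_append, List.nil_append] at h5 h6 h7
  convert sub_mem h7 (add_mem (add_mem (add_mem h1 h2) (add_mem h3 h4)) (add_mem h5 h6)) using 1
  module

/-- The words with inner `e₁` are `[k, 1, l, m]`, `[k, l, 1, m]`, `[l, k, 1, m]` and `[k + l, 1,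
m]`. The first two corrections telescope, which removes the weight on `l`. -/
theorem gshMap_ds_two_two_sub_mem {k l m : ℕ+} (hk : k ≠ 1) (hl : l ≠ 1) (hm : m ≠ 1) {n : ℕ}
    (hn : (k : ℕ) + l + m ≤ n) :
    gshMap (ds [k, 1] [l, m]) - (1 / 2 : ℚ) •
      (nest [letter k, letter l, indexLetter m] 0 - nest [indexLetter k, letter l, letter m] 0 +
        nest [letter l, letter k, indexLetter m] 0 - nest [letter l, indexLetter k, letter m] 0 +
        nest [letter (k + l), indexLetter m] 0 - nest [indexLetter (k + l), letter m] 0) ∈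
      gshLE n := by
  have hkl : k + l ≠ 1 :=
    ne_one_of_two_le (by have := PNat.pos k; have := PNat.pos l; simp; omega)
  have hkm : k + m ≠ 1 :=
    ne_one_of_two_le (by have := PNat.pos k; have := PNat.pos m; simp; omega)
  have hl' : 1 + l ≠ 1 :=
    ne_one_of_two_le (by have := PNat.pos 1; have := PNat.pos l; simp; omega)
  have h1 : nest [letter k, letter l, letter m] 0 ∈ gshLE n :=
    nest_mem_gshLE (ks := [k, l, m]) (by simp [NoInnerOne, hk, hl])
      (by simp [weight] at *; omega)
  have h2 : nest [letter l, letter k, letter m] 0 ∈ gshLE n :=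
    nest_mem_gshLE (ks := [l, k, m]) (by simp [NoInnerOne, hk, hl])
      (by simp [weight] at *; omega)
  have h3 : nest [letter (k + l), letter m] 0 ∈ gshLE n :=
    nest_mem_gshLE (ks := [k + l, m]) (by simp [NoInnerOne, hkl])
      (by simp [weight] at *; omega)
  have e1 := nest_letter_mul_letter_sub_mem (gshLE n) [letter k, letter l] [] (k := 1) (l := m)
    (Or.inr hm) fun j hj hj' => nest_mem_gshLE (ks := [k, l, j])
      (by simp [NoInnerOne, hk, hl]) (by simp [weight] at *; omega)
  have e2 := nest_letter_mul_letter_sub_mem (gshLE n) [letter k] [letter m] (k := 1) (l := l)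
    (Or.inr hl) fun j hj hj' => nest_mem_gshLE (ks := [k, j, m])
      (by simp [NoInnerOne, hk, ne_one_of_two_le hj]) (by simp [weight] at *; omega)
  have e3 := nest_letter_mul_letter_sub_mem (gshLE n) [letter l, letter k] [] (k := 1) (l := m)
    (Or.inr hm) fun j hj hj' => nest_mem_gshLE (ks := [l, k, j])
      (by simp [NoInnerOne, hk, hl]) (by simp [weight] at *; omega)
  have e4 := nest_letter_mul_letter_sub_mem (gshLE n) [letter l] [letter 1] (k := k) (l := m)
    (Or.inl hk) fun j hj hj' => nest_mem_gshLE (ks := [l, j, 1])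
      (by simp [NoInnerOne, hl, ne_one_of_two_le hj]) (by simp [weight] at *; omega)
  have e5 := nest_letter_mul_letter_sub_mem (gshLE n) [] [letter m, letter 1] (k := k) (l := l)
    (Or.inl hk) fun j hj hj' => nest_mem_gshLE (ks := [j, m, 1])
      (by simp [NoInnerOne, hm, ne_one_of_two_le hj]) (by simp [weight] at *; omega)
  -- The lower terms have an inner `e₁`, hence `nest_letter_one_letter_mem`.
  have e6 := nest_letter_mul_letter_sub_mem (gshLE n) [] [letter 1, letter m] (k := k) (l := l)
    (Or.inl hk) fun j hj hj' => nest_letter_one_letter_mem (ne_one_of_two_le hj) hm (by omega)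
  have e7 := nest_letter_mul_letter_sub_mem (gshLE n) [letter (k + l)] [] (k := 1) (l := m)
    (Or.inr hm) fun j hj hj' => nest_mem_gshLE (ks := [k + l, j])
      (by simp [NoInnerOne, hkl]) (by simp [weight] at *; omega)
  -- Two simultaneous collisions: the first position is reduced here, with the second product left
  -- intact, and `e7` then reduces the second.
  have e8 := nest_letter_mul_letter_sub_mem (gshLE n) [] [fun b => letter 1 b * letter m b] (k := k)
    (l := l) (Or.inl hk) fun j hj hj' => by
    have hj1 := ne_one_of_two_le hj
    have h := nest_letter_mul_letter_sub_mem (gshLE n) [letter j] [] (k := 1) (l := m)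
      (Or.inr hm) fun i hi hi' => nest_mem_gshLE (ks := [j, i])
        (by simp [NoInnerOne, hj1]) (by simp [weight] at *; omega)
    have h' : nest [letter j, letter (1 + m)] 0 ∈ gshLE n :=
      nest_mem_gshLE (ks := [j, 1 + m]) (by simp [NoInnerOne, hj1]) (by simp [weight] at *; omega)
    convert add_mem h h' using 1
    simp
  have hp := nest_letters_mul [k, 1] [l, m]
  rw [gshMap_ds, gsh_eq_nest (ks := [k, 1]) (by simp [NoInnerOne, hk]),
    gsh_eq_nest (ks := [l, m]) (by simp [NoInnerOne, hl]), hp]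
  simp only [stuffle, quasiShuffle, map_add, prepend_single, gshMap_single, List.map_cons,
    List.map_nil, List.sum_cons, List.sum_nil, List.cons_append, List.nil_append]
  rw [gsh_cons_one_cons hk hl (by simp [NoInnerOne]),
    gsh_cons_cons_one_cons hk hl hm (by simp [NoInnerOne]),
    gsh_cons_cons_one_cons hl hk hm (by simp [NoInnerOne]),
    gsh_cons_one_cons hkl hm (by simp [NoInnerOne]),
    gsh_eq_nest (ks := [k, l, m, 1]) (by simp [NoInnerOne, hk, hl, hm]),
    gsh_eq_nest (ks := [k, l, 1 + m]) (by simp [NoInnerOne, hk, hl]),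
    gsh_eq_nest (ks := [k, 1 + l, m]) (by simp [NoInnerOne, hk, hl']),
    gsh_eq_nest (ks := [l, k, m, 1]) (by simp [NoInnerOne, hk, hl, hm]),
    gsh_eq_nest (ks := [l, k, 1 + m]) (by simp [NoInnerOne, hk, hl]),
    gsh_eq_nest (ks := [l, m, k, 1]) (by simp [NoInnerOne, hk, hl, hm]),
    gsh_eq_nest (ks := [l, k + m, 1]) (by simp [NoInnerOne, hl, hkm]),
    gsh_eq_nest (ks := [k + l, m, 1]) (by simp [NoInnerOne, hkl, hm]),
    gsh_eq_nest (ks := [k + l, 1 + m]) (by simp [NoInnerOne, hkl])]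
  convert sub_mem (neg_mem (add_mem (add_mem (add_mem e1 e2) (add_mem e3 e4))
    (add_mem (add_mem e5 e6) (add_mem e7 e8)))) (add_mem h1 ((gshLE n).smul_mem (1 / 2)
      (add_mem h2 h3))) using 1
  simp only [List.map_cons, List.map_nil, List.nil_append, List.cons_append]
  module

/-! ### Derivatives of nested sums -/

theorem qD_nest_letter_cons (k : ℕ+) (fs : List (ℕ → ℚ⟦X⟧)) (M : ℕ) :
    qD (nest (letter k :: fs) M) = (k : ℚ) • nest (indexLetter (k + 1) :: fs) M +
      bsum M fun b => letter k b * qD (nest fs b) := by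
  rw [qD_nest_cons]
  congr 1
  simp_rw [qD_letter]
  exact nest_smul [] fs _ _ M

theorem qD_nest_nil (M : ℕ) : qD (nest [] M) = 0 := by simp [nest, qD]

theorem qD_nest_one (k : ℕ+) (M : ℕ) :
    qD (nest [letter k] M) = (k : ℚ) • nest [indexLetter (k + 1)] M := by
  rw [qD_nest_letter_cons]
  simp_rw [qD_nest_nil, mul_zero]
  rw [show bsum M (fun _ => 0) = 0 by ext n; simp [coeff_bsum], add_zero]

theorem qD_nest_two (k l : ℕ+) (M : ℕ) :
    qD (nest [letter k, letter l] M) = (k : ℚ) • nest [indexLetter (k + 1), letter l] M +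
      (l : ℚ) • nest [letter k, indexLetter (l + 1)] M := by
  rw [qD_nest_letter_cons]
  simp_rw [qD_nest_one, mul_smul_comm, bsum_smul]
  rfl

theorem qD_nest_three (k l m : ℕ+) (M : ℕ) :
    qD (nest [letter k, letter l, letter m] M) =
      (k : ℚ) • nest [indexLetter (k + 1), letter l, letter m] M +
      (l : ℚ) • nest [letter k, indexLetter (l + 1), letter m] M +
      (m : ℚ) • nest [letter k, letter l, indexLetter (m + 1)] M := by
  rw [qD_nest_letter_cons]
  simp_rw [qD_nest_two, mul_add, mul_smul_comm, bsum_add, bsum_smul]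
  rw [add_assoc]
  rfl

theorem mem_span_range_of_sub_gshMap_mem {f : ℚ⟦X⟧} {x : H1} {n : ℕ}
    (h : f - gshMap x ∈ gshLE n) : f ∈ Submodule.span ℚ (Set.range gsh) := by
  simpa using add_mem (gshLE_le_span_range n h) (gshMap_mem_span_range x)

end QMZV

end

/-! ### The derivative formulas in depth two and three -/

theorem theorem4p8 (k₁ k₂ k₃ : ℕ+) (hk₁ : 2 ≤ k₁) (hk₂ : 2 ≤ k₂) (hk₃ : 2 ≤ k₃) :
    (qD (gsh [k₁, k₂]) ≡
        (2 * (k₁ : ℚ)) • (gshMap (ds [1] [k₁ + 1, k₂]) - gshMap (ds [k₂] [k₁ + 1, 1]))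
        + (2 * (k₂ : ℚ)) • gshMap (ds [1] [k₁, k₂ + 1])
      [SMOD gshLE (k₁ + k₂ + 1)]) ∧
    (qD (gsh [k₁, k₂, k₃]) ≡
        (2 * (k₁ : ℚ)) • gshMap (ds [1] [k₁ + 1, k₂, k₃] + ds [k₃] [k₂, k₁ + 1, 1])
        + (2 * (k₁ : ℚ)) • gshMap (ds [k₃] [k₁ + 1 + k₂, 1] - ds [k₁ + 1, 1] [k₂, k₃])
        + (2 * (k₂ : ℚ)) • gshMap (ds [1] [k₁, k₂ + 1, k₃] - ds [k₃] [k₁, k₂ + 1, 1])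
        + (2 * (k₃ : ℚ)) • gshMap (ds [1] [k₁, k₂, k₃ + 1])
      [SMOD gshLE (k₁ + k₂ + k₃ + 1)]) ∧
    qD (gsh [k₁, k₂]) ∈ Submodule.span ℚ (Set.range gsh) ∧
    qD (gsh [k₁, k₂, k₃]) ∈ Submodule.span ℚ (Set.range gsh) := by
  have h1 : k₁ ≠ 1 := by rintro rfl; exact absurd hk₁ (by decide)
  have h2 : k₂ ≠ 1 := by rintro rfl; exact absurd hk₂ (by decide)
  have h3 : k₃ ≠ 1 := by rintro rfl; exact absurd hk₃ (by decide)
  have h1' : k₁ + 1 ≠ 1 := ne_one_of_two_le (by have := k₁.pos; simp; omega)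
  have h2' : k₂ + 1 ≠ 1 := ne_one_of_two_le (by have := k₂.pos; simp; omega)
  have h3' : k₃ + 1 ≠ 1 := ne_one_of_two_le (by have := k₃.pos; simp; omega)
  have h12 : k₁ + 1 + k₂ ≠ 1 := ne_one_of_two_le (by have := k₁.pos; have := k₂.pos; simp; omega)
  have hd2 := qD_nest_two k₁ k₂ 0
  have hd3 := qD_nest_three k₁ k₂ k₃ 0
  have hg2 : gsh [k₁, k₂] = nest [letter k₁, letter k₂] 0 :=
    gsh_eq_nest (ks := [k₁, k₂]) (by simp [NoInnerOne, h1])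
  have hg3 : gsh [k₁, k₂, k₃] = nest [letter k₁, letter k₂, letter k₃] 0 :=
    gsh_eq_nest (ks := [k₁, k₂, k₃]) (by simp [NoInnerOne, h1, h2])
  have hdepth2 : qD (gsh [k₁, k₂]) ≡
        (2 * (k₁ : ℚ)) • (gshMap (ds [1] [k₁ + 1, k₂]) - gshMap (ds [k₂] [k₁ + 1, 1]))
        + (2 * (k₂ : ℚ)) • gshMap (ds [1] [k₁, k₂ + 1])
      [SMOD gshLE (k₁ + k₂ + 1)] := by
    rw [SModEq.sub_mem, hg2, hd2]
    -- The term with the index weight on `k₂` cancels in `e1 - e2`, leaving half the sum weighted on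
    -- `k₁ + 1`; `e3` gives the other term of the derivative.
    have e1 := gshMap_ds_one_two_sub_mem (n := k₁ + k₂ + 1) h1' h2 (by simp; omega)
    have e2 := gshMap_ds_two_one_sub_mem (n := k₁ + k₂ + 1) h2 h1' (by simp; omega)
    have e3 := gshMap_ds_one_two_sub_mem (n := k₁ + k₂ + 1) h1 h2' (by simp; omega)
    convert neg_mem (add_mem (Submodule.smul_mem _ (2 * (k₁ : ℚ)) (sub_mem e1 e2))
      (Submodule.smul_mem _ (2 * (k₂ : ℚ)) e3)) using 1
    module
  have hdepth3 : qD (gsh [k₁, k₂, k₃]) ≡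
        (2 * (k₁ : ℚ)) • gshMap (ds [1] [k₁ + 1, k₂, k₃] + ds [k₃] [k₂, k₁ + 1, 1])
        + (2 * (k₁ : ℚ)) • gshMap (ds [k₃] [k₁ + 1 + k₂, 1] - ds [k₁ + 1, 1] [k₂, k₃])
        + (2 * (k₂ : ℚ)) • gshMap (ds [1] [k₁, k₂ + 1, k₃] - ds [k₃] [k₁, k₂ + 1, 1])
        + (2 * (k₃ : ℚ)) • gshMap (ds [1] [k₁, k₂, k₃ + 1])
      [SMOD gshLE (k₁ + k₂ + k₃ + 1)] := by
    rw [SModEq.sub_mem, hg3, hd3]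
    -- Of the six terms of `e4`, five are matched by `e1`, `e2` and `e3`; in `e1 + e2 + e3 - e4`
    -- only the weight on the first letter `k₁ + 1` survives. Likewise `e5 - e6` isolates the middle
    -- letter and `e7` the last.
    have e1 := gshMap_ds_one_three_sub_mem (n := k₁ + k₂ + k₃ + 1) h1' h2 h3 (by simp; omega)
    have e2 := gshMap_ds_three_one_sub_mem (n := k₁ + k₂ + k₃ + 1) h3 h2 h1' (by simp; omega)
    have e3 := gshMap_ds_two_one_sub_mem (n := k₁ + k₂ + k₃ + 1) h3 h12 (by simp; omega)
    have e4 := gshMap_ds_two_two_sub_mem (n := k₁ + k₂ + k₃ + 1) h1' h2 h3 (by simp; omega)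
    have e5 := gshMap_ds_one_three_sub_mem (n := k₁ + k₂ + k₃ + 1) h1 h2' h3 (by simp; omega)
    have e6 := gshMap_ds_three_one_sub_mem (n := k₁ + k₂ + k₃ + 1) h3 h1 h2' (by simp; omega)
    have e7 := gshMap_ds_one_three_sub_mem (n := k₁ + k₂ + k₃ + 1) h1 h2 h3' (by simp; omega)
    convert neg_mem (add_mem (add_mem (add_mem
      (Submodule.smul_mem _ (2 * (k₁ : ℚ)) (add_mem e1 e2))
      (Submodule.smul_mem _ (2 * (k₁ : ℚ)) (sub_mem e3 e4)))
      (Submodule.smul_mem _ (2 * (k₂ : ℚ)) (sub_mem e5 e6)))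
      (Submodule.smul_mem _ (2 * (k₃ : ℚ)) e7)) using 1
    simp only [map_add, map_sub]
    module
  refine ⟨hdepth2, hdepth3, ?_, ?_⟩
  · rw [SModEq.sub_mem] at hdepth2
    -- The right-hand side is gathered into `gshMap` of a single element.
    rw [← map_sub, ← map_smul, ← map_smul, ← map_add] at hdepth2
    exact mem_span_range_of_sub_gshMap_mem hdepth2
  · rw [SModEq.sub_mem, ← map_smul, ← map_smul, ← map_smul, ← map_smul, ← map_add, ← map_add,
      ← map_add] at hdepth3
    exact mem_span_range_of_sub_gshMap_mem hdepth3
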